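/- Let $(\zeta_i)_{i\ge 0}$ be i.i.d. random vectors with values in $\mathbb Z^2$ on a probability space $(\Omega,\mathbb P)$, with zero mean, finite second moment and nonsingular covariance matrix $\Sigma$, and aperiodic: the vectors $\ell$ with $\mathbb P(\zeta_0=\ell)>0$ generate the group $\mathbb Z^2$. Let $Z_0=0$, $Z_n=\zeta_0+\dots+\zeta_{n-1}$, and put $C_0=(\pi\sqrt{\det\Sigma})^{-1}$. Let $T_1,T_2$ be commuting invertible measure preserving transformations of a probability space $(E,\mu)$, let $T^\ell f(x)=f(T_1^{\ell_1}T_2^{\ell_2}x)$ for $\ell=(\ell_1,\ell_2)\in\mathbb Z^2$, and let $f\in L^2(E,\mu)$ be a real function with a continuous spectral density, i.e. there is a continuous real function $\varphi_f$ on $\mathbb T^2=(\mathbb R/\mathbb Z)^2$ with $$\int_E T^k f\cdot f\,d\mu=\int_{\mathbb T^2}e^{2\pi i\langle k,t\rangle}\varphi_f(t)\,dt\qquad\text{for all }k\in\mathbb Z^2,$$ where $dt$ is the Haar probability measure. Then for $\mathbb P$-almost every $\omega$ the following holds: for all $s\ge 1$, all real numbers $a_1,\dots,a_s$ and all subdivisions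 $0=t_0<t_1<\dots<t_s=1$, $$\frac{1}{C_0\,n\ln n}\,\Big\|\sum_{j=1}^s a_j\sum_{k=\lfloor nt_{j-1}\rfloor}^{\lfloor nt_j\rfloor}T^{Z_k(\omega)}f\Big\|_{L^2(\mu)}^2\;\longrightarrow\;\varphi_f(0)\sum_{j=1}^s a_j^2\,(t_j-t_{j-1})\qquad(n\to\infty).$$ -/

import Mathlib

open MeasureTheory ProbabilityTheory Filter Topology

noncomputable section

namespace QuenchedRW

/-- The random walk with steps `ζ 0, ζ 1, …`, started at the origin:
`Z 0 = 0` and `Z n = ζ 0 + ⋯ + ζ (n - 1)`. -/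
def walk {Ω : Type*} (ζ : ℕ → Ω → (Fin 2 → ℤ)) (n : ℕ) (ω : Ω) : Fin 2 → ℤ :=
  ∑ i ∈ Finset.range n, ζ i ω

/-- A step distribution is aperiodic if the vectors of positive probability generate the group
`ℤ²`. -/
def IsAperiodic {Ω : Type*} [MeasurableSpace Ω] (P : Measure Ω) (ξ : Ω → (Fin 2 → ℤ)) : Prop :=
  AddSubgroup.closure {l : Fin 2 → ℤ | 0 < P {ω | ξ ω = l}} = ⊤

/-- The covariance matrix of a random vector with values in `ℤ²`. -/
def covMatrix {Ω : Type*} [MeasurableSpace Ω] (P : Measure Ω) (ξ : Ω → (Fin 2 → ℤ)) :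
    Matrix (Fin 2) (Fin 2) ℝ :=
  Matrix.of fun i j => covariance (fun ω => (ξ ω i : ℝ)) (fun ω => (ξ ω j : ℝ)) P

/-- The constant `C₀ = (π √(det S))⁻¹` attached to a planar walk with step covariance `S`. -/
def selfIntersectionConst (S : Matrix (Fin 2) (Fin 2) ℝ) : ℝ :=
  (Real.pi * Real.sqrt S.det)⁻¹

/-- The map `T^l = T₁^{l₁} T₂^{l₂}`, for `l ∈ ℤ²`. -/
def zAction {E : Type*} [MeasurableSpace E] (T₁ T₂ : E ≃ᵐ E) (l : Fin 2 → ℤ) (x : E) : E :=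
  ((T₁.toEquiv : Equiv.Perm E) ^ (l 0)) (((T₂.toEquiv : Equiv.Perm E) ^ (l 1)) x)

/-- The Haar probability measure `dt` on the torus `𝕋² = (ℝ/ℤ)²`. -/
def torusHaar : Measure (UnitAddTorus (Fin 2)) :=
  Measure.pi fun _ => AddCircle.haarAddCircle

/-- The function `φ` on `𝕋²` is a continuous spectral density of the real function `f`:
`∫ (T^k f) f dμ = ∫ e^{2π i ⟨k, t⟩} φ(t) dt` for all `k ∈ ℤ²`. Here `mFourier k` is the character
`t ↦ e^{2π i ⟨k, t⟩}`. -/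
def IsContinuousSpectralDensity {E : Type*} [MeasurableSpace E] (μ : Measure E)
    (T₁ T₂ : E ≃ᵐ E) (f : E → ℝ) (φ : UnitAddTorus (Fin 2) → ℝ) : Prop :=
  Continuous φ ∧ ∀ k : Fin 2 → ℤ,
    ((∫ x, f (zAction T₁ T₂ k x) * f x ∂μ : ℝ) : ℂ) =
      ∫ t, UnitAddTorus.mFourier k t * (φ t : ℂ) ∂torusHaar

/-- The weighted block sum `∑_{j=1}^s a_j ∑_{k=⌊n t_{j-1}⌋}^{⌊n t_j⌋} T^{Z_k(ω)} f (x)`; the index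
`j : Fin s` stands for the `j + 1` of the formula. -/
def blockSum {Ω E : Type*} [MeasurableSpace E] (ζ : ℕ → Ω → (Fin 2 → ℤ))
    (T₁ T₂ : E ≃ᵐ E) (f : E → ℝ) {s : ℕ} (a : Fin s → ℝ) (t : Fin (s + 1) → ℝ)
    (n : ℕ) (ω : Ω) (x : E) : ℝ :=
  ∑ j : Fin s, a j * ∑ k ∈ Finset.Icc ⌊(n : ℝ) * t j.castSucc⌋₊ ⌊(n : ℝ) * t j.succ⌋₊,
    f (zAction T₁ T₂ (walk ζ k ω) x)

end QuenchedRW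

end

/-!
Let `N_n(l)` count the pairs of times `i, j < n` with `Z_i - Z_j = l`. Under the spectral isometry,
a block sum becomes a trigonometric polynomial whose squared modulus has Fourier coefficients built
from such pair counts, so by Weyl's criterion it is enough to show that, almost surely, the
coefficient of every frequency has the same limit: the normalised densities then converge weakly to
a multiple of the point mass at `0`, and are tested against `φ`.

Mean: the characteristic function `χ` of a step satisfies `1 - χ(t) ~ 2π² ⟨t, Σ t⟩` at `0` and, by
aperiodicity, `χ ≠ 1` elsewhere. Comparing with a Gaussian integral gives the growth `log n` of the
Green function, hence `E[N_n(l)] ~ C₀ n log n`.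

Concentration: `Var N_n(l) = O(n²)`, so Chebyshev and Borel–Cantelli give almost sure convergence
along `n_k = ⌊exp(k^{3/4})⌋`, a sequence sparse enough for summability and with `n_{k+1} / n_k → 1`;
monotonicity in the block fills in the other `n`. Different blocks do not interact to leading order,
by additivity of the limit over consecutive blocks.
-/

namespace QuenchedRW

open UnitAddTorus Finset
open scoped ComplexConjugate ENNReal NNReal

section LatticeCharFun

variable {d Ω : Type*} [Fintype d] [MeasurableSpace Ω] {P : Measure Ω} {X Y : Ω → d → ℤ}

/-- The characteristic function `t ↦ E[e^{2π i ⟨X, t⟩}]` of a random vector `X` with values in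
the lattice `ℤᵈ`, as a function on the dual torus `(ℝ/ℤ)ᵈ`. -/
noncomputable def latticeCharFun (P : Measure Ω) (X : Ω → d → ℤ) (t : UnitAddTorus d) : ℂ :=
  ∫ ω, mFourier (X ω) t ∂P

theorem norm_mFourier_apply (k : d → ℤ) (t : UnitAddTorus d) : ‖mFourier k t‖ = 1 := by
  simp only [mFourier, fourier_apply, ContinuousMap.coe_mk, norm_prod, Circle.norm_coe,
    prod_const_one]

theorem mFourier_apply_zero (k : d → ℤ) : mFourier k (0 : UnitAddTorus d) = 1 := by
  simp [mFourier]

theorem mFourier_sum {ι : Type*} (s : Finset ι) (k : ι → d → ℤ) (t : UnitAddTorus d) :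
    mFourier (∑ i ∈ s, k i) t = ∏ i ∈ s, mFourier (k i) t := by
  classical
  induction s using Finset.induction_on with
  | empty => simp [mFourier_zero]
  | insert i s hi ih => rw [sum_insert hi, prod_insert hi, mFourier_add, ih]

theorem eq_zero_of_forall_mFourier_eq_one {t : UnitAddTorus d}
    (h : ∀ k : d → ℤ, mFourier k t = 1) : t = 0 := by
  classical
  funext i
  have hi := h (Pi.single i 1)
  rw [mFourier_single, fourier_one, ← Circle.coe_one, Circle.coe_inj,
    ← AddCircle.toCircle_zero] at hi
  exact AddCircle.injective_toCircle one_ne_zero hi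

theorem integrable_mFourier_comp [IsFiniteMeasure P] (hX : Measurable X) (t : UnitAddTorus d) :
    Integrable (fun ω => mFourier (X ω) t) P :=
  .of_bound ((measurable_of_countable fun k => mFourier k t).comp hX).aestronglyMeasurable 1
    (ae_of_all _ fun ω => (norm_mFourier_apply (X ω) t).le)

theorem norm_latticeCharFun_le_one [IsProbabilityMeasure P] (t : UnitAddTorus d) :
    ‖latticeCharFun P X t‖ ≤ 1 :=
  (norm_integral_le_integral_norm _).trans (by simp [norm_mFourier_apply])

theorem continuous_latticeCharFun [IsFiniteMeasure P] (hX : Measurable X) :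
    Continuous (latticeCharFun P X) :=
  continuous_of_dominated (bound := fun _ => 1)
    (fun t => (integrable_mFourier_comp hX t).aestronglyMeasurable)
    (fun t => ae_of_all _ fun ω => (norm_mFourier_apply (X ω) t).le) (integrable_const _)
    (ae_of_all _ fun ω => (mFourier (X ω)).continuous)

theorem latticeCharFun_congr (h : IdentDistrib X Y P P) :
    latticeCharFun P X = latticeCharFun P Y :=
  funext fun t => (h.comp (measurable_of_countable fun k => mFourier k t)).integral_eq

theorem latticeCharFun_sum {ι : Type*} {ξ : ι → Ω → d → ℤ} (hmeas : ∀ i, Measurable (ξ i))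
    (hindep : iIndepFun ξ P) (s : Finset ι) (t : UnitAddTorus d) :
    latticeCharFun P (fun ω => ∑ i ∈ s, ξ i ω) t = ∏ i ∈ s, latticeCharFun P (ξ i) t := by
  simp_rw [latticeCharFun, mFourier_sum, ← prod_coe_sort s]
  exact (hindep.precomp (g := ((↑) : s → ι)) Subtype.val_injective).integral_fun_prod_comp
    (f := fun _ k => mFourier k t) (fun i => (hmeas i).aemeasurable)
    (fun _ => (measurable_of_countable _).aestronglyMeasurable)

theorem latticeCharFun_sum_of_identDistrib {ι : Type*} {ξ : ι → Ω → d → ℤ}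
    (hmeas : ∀ i, Measurable (ξ i)) (hindep : iIndepFun ξ P)
    (hident : ∀ i, IdentDistrib (ξ i) X P P) (s : Finset ι) (t : UnitAddTorus d) :
    latticeCharFun P (fun ω => ∑ i ∈ s, ξ i ω) t = latticeCharFun P X t ^ #s := by
  rw [latticeCharFun_sum hmeas hindep, ← prod_const]
  exact prod_congr rfl fun i _ => congrFun (latticeCharFun_congr (hident i)) t

theorem ae_mFourier_eq_one [IsProbabilityMeasure P] (hX : Measurable X) {t : UnitAddTorus d}
    (h : latticeCharFun P X t = 1) : ∀ᵐ ω ∂P, mFourier (X ω) t = 1 := by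
  have hint := integrable_mFourier_comp (P := P) hX t
  have hint_re : Integrable (fun ω => (mFourier (X ω) t).re) P := hint.re
  have hre : ∀ ω, (mFourier (X ω) t).re ≤ 1 := fun ω =>
    (Complex.re_le_norm _).trans (norm_mFourier_apply _ _).le
  have hzero : ∫ ω, (1 - (mFourier (X ω) t).re) ∂P = 0 := by
    have : ∫ ω, (mFourier (X ω) t).re ∂P = (latticeCharFun P X t).re := integral_re hint
    rw [integral_sub (integrable_const _) hint_re, this, h]
    simp
  rw [integral_eq_zero_iff_of_nonneg (fun ω => sub_nonneg.2 (hre ω))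
    ((integrable_const _).sub hint_re)] at hzero
  filter_upwards [hzero] with ω hω
  have hre_eq : (mFourier (X ω) t).re = 1 := (sub_eq_zero.1 hω).symm
  have him := Complex.sq_norm_sub_sq_re (mFourier (X ω) t)
  rw [norm_mFourier_apply, hre_eq] at him
  exact Complex.ext hre_eq (by simpa using him.symm)

theorem eq_zero_of_latticeCharFun_eq_one [IsProbabilityMeasure P] (hX : Measurable X)
    (haper : AddSubgroup.closure {l : d → ℤ | 0 < P {ω | X ω = l}} = ⊤) {t : UnitAddTorus d}
    (h : latticeCharFun P X t = 1) : t = 0 := by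
  refine eq_zero_of_forall_mFourier_eq_one fun k => ?_
  have hk : k ∈ AddSubgroup.closure {l : d → ℤ | 0 < P {ω | X ω = l}} := haper ▸ trivial
  induction hk using AddSubgroup.closure_induction with
  | mem l hl =>
    by_contra hne
    refine hl.ne' (measure_mono_null (fun ω (hω : X ω = l) => ?_) (ae_mFourier_eq_one hX h))
    simpa only [Set.mem_compl_iff, Set.mem_ofPred_eq, hω] using hne
  | zero => rw [mFourier_zero, ContinuousMap.one_apply]
  | add k l _ _ hk hl => rw [mFourier_add, hk, hl, one_mul]
  | neg k _ hk => rw [mFourier_neg, hk, map_one]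

theorem exists_le_norm_one_sub_latticeCharFun [IsProbabilityMeasure P] (hX : Measurable X)
    (haper : AddSubgroup.closure {l : d → ℤ | 0 < P {ω | X ω = l}} = ⊤)
    {U : Set (UnitAddTorus d)} (hU : U ∈ 𝓝 0) :
    ∃ c > 0, ∀ t ∉ U, c ≤ ‖1 - latticeCharFun P X t‖ := by
  obtain ⟨c, hc, hle⟩ := (isOpen_interior (s := U)).isClosed_compl.isCompact.exists_forall_le'
    (f := fun t => ‖1 - latticeCharFun P X t‖) (a := 0)
    (continuous_const.sub (continuous_latticeCharFun hX)).norm.continuousOn fun t ht => by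
      refine norm_pos_iff.2 (sub_ne_zero.2 fun h => ht ?_)
      rw [eq_zero_of_latticeCharFun_eq_one hX haper h.symm]
      exact mem_interior_iff_mem_nhds.2 hU
  exact ⟨c, hc, fun t ht => hle t fun h => ht (interior_subset h)⟩

end LatticeCharFun

section PlanarTorus

instance : IsProbabilityMeasure torusHaar :=
  inferInstanceAs (IsProbabilityMeasure (Measure.pi fun _ => AddCircle.haarAddCircle))

theorem integral_mFourier (k : Fin 2 → ℤ) :
    ∫ t, mFourier k t ∂torusHaar = if k = 0 then 1 else 0 := by
  have hcoord : ∀ m : ℤ,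
      ∫ x : UnitAddCircle, fourier m x ∂AddCircle.haarAddCircle = if m = 0 then 1 else 0 := by
    intro m
    split_ifs with h
    · simp [h]
    · exact integral_eq_zero_of_add_right_eq_neg (fourier_add_half_inv_index h one_pos)
  refine (integral_fintype_prod_eq_prod fun i (x : UnitAddCircle) => (fourier (k i) x : ℂ)).trans ?_
  simp_rw [hcoord, prod_ite_zero, funext_iff]
  simp

theorem integrable_of_continuous {d E : Type*} [Finite d] [NormedAddCommGroup E]
    {ν : Measure (UnitAddTorus d)} [IsFiniteMeasure ν] {g : UnitAddTorus d → E}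
    (hg : Continuous g) : Integrable g ν :=
  hg.integrable_of_hasCompactSupport (HasCompactSupport.of_compactSpace g)

theorem mFourierCoeff_eq_integral_torusHaar (g : UnitAddTorus (Fin 2) → ℂ) (l : Fin 2 → ℤ) :
    mFourierCoeff g l = ∫ t, mFourier (-l) t * g t ∂torusHaar := rfl

theorem mFourierCoeff_sum {ι : Type*} (s : Finset ι) {g : ι → UnitAddTorus (Fin 2) → ℂ}
    (hg : ∀ i ∈ s, Continuous (g i)) (l : Fin 2 → ℤ) :
    mFourierCoeff (fun t => ∑ i ∈ s, g i t) l = ∑ i ∈ s, mFourierCoeff (g i) l := by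
  simp_rw [mFourierCoeff_eq_integral_torusHaar, mul_sum]
  exact integral_finsetSum _ fun i hi =>
    integrable_of_continuous ((mFourier (-l)).continuous.mul (hg i hi))

theorem hasSum_sq_norm_mFourierCoeff {g : UnitAddTorus (Fin 2) → ℂ} (hg : Continuous g) :
    HasSum (fun l => ‖mFourierCoeff g l‖ ^ 2) (∫ t, ‖g t‖ ^ 2 ∂torusHaar) := by
  have hL2 : MemLp g 2 torusHaar := hg.memLp_of_hasCompactSupport (.of_compactSpace g)
  have hparseval := hasSum_sq_mFourierCoeff (d := Fin 2) (hL2.toLp g)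
  have hcoeff : ∀ l, mFourierCoeff (hL2.toLp g) l = mFourierCoeff g l := fun l =>
    integral_congr_ae (hL2.coeFn_toLp.mono fun t ht => congrArg (mFourier (-l) t • ·) ht)
  have hint : ∫ t, ‖(hL2.toLp g) t‖ ^ 2 ∂torusHaar = ∫ t, ‖g t‖ ^ 2 ∂torusHaar :=
    integral_congr_ae (hL2.coeFn_toLp.mono fun t ht => congrArg (‖·‖ ^ 2) ht)
  rw [← hint, ← funext fun l => congrArg (‖·‖ ^ 2) (hcoeff l)]
  exact hparseval

theorem mFourierCoeff_latticeCharFun {Ω : Type*} [MeasurableSpace Ω] {P : Measure Ω}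
    [IsFiniteMeasure P] {X : Ω → Fin 2 → ℤ} (hX : Measurable X) (l : Fin 2 → ℤ) :
    mFourierCoeff (latticeCharFun P X) l = P.real {ω | X ω = l} := by
  have hpair : Measurable fun p : UnitAddTorus (Fin 2) × (Fin 2 → ℤ) => mFourier p.2 p.1 :=
    measurable_from_prod_countable_left fun k => (mFourier k).continuous.measurable
  have hmeas : Measurable fun p : UnitAddTorus (Fin 2) × Ω => mFourier (-l + X p.2) p.1 := by
    have hshift : Measurable fun p : UnitAddTorus (Fin 2) × Ω => (p.1, -l + X p.2) := by fun_prop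
    simpa only [Function.comp_def] using hpair.comp hshift
  have hinner : ∀ ω, ∫ t, mFourier (-l + X ω) t ∂torusHaar =
      Set.indicator {ω | X ω = l} (fun _ => 1) ω := fun ω => by
    simp_rw [integral_mFourier, neg_add_eq_zero, Set.indicator_apply, Set.mem_ofPred_eq, eq_comm]
  calc mFourierCoeff (latticeCharFun P X) l
      = ∫ t, ∫ ω, mFourier (-l + X ω) t ∂P ∂torusHaar := by
        simp_rw [mFourierCoeff_eq_integral_torusHaar, latticeCharFun, ← integral_const_mul,
          mFourier_add]
    _ = ∫ ω, ∫ t, mFourier (-l + X ω) t ∂torusHaar ∂P :=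
        integral_integral_swap (.of_bound hmeas.aestronglyMeasurable 1
          (ae_of_all _ fun _ => (norm_mFourier_apply _ _).le))
    _ = P.real {ω | X ω = l} := by
        have hevent : MeasurableSet {ω | X ω = l} := hX (measurableSet_singleton l)
        rw [funext hinner, integral_indicator_const 1 hevent, Complex.real_smul, mul_one]

end PlanarTorus

section GaussianIntegral

open Matrix
open scoped MatrixOrder

variable {d : Type*} [Fintype d] {S : Matrix d d ℝ}

theorem exists_eq_transpose_mul_self [DecidableEq d] (hS : S.PosDef) :
    ∃ B : Matrix d d ℝ, S = Bᵀ * B ∧ B.det ≠ 0 := by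
  obtain ⟨B, hB⟩ := CStarAlgebra.nonneg_iff_eq_star_mul_self.1 hS.posSemidef.nonneg
  refine ⟨B, hB, fun hdet => hS.det_pos.ne' ?_⟩
  rw [hB, det_mul, hdet, mul_zero]

theorem dotProduct_transpose_mul_self_mulVec (B : Matrix d d ℝ) (x : d → ℝ) :
    x ⬝ᵥ (Bᵀ * B) *ᵥ x = B *ᵥ x ⬝ᵥ B *ᵥ x := by
  rw [← mulVec_mulVec, dotProduct_mulVec, vecMul_transpose]

theorem sq_norm_le_dotProduct_self (x : d → ℝ) : ‖x‖ ^ 2 ≤ x ⬝ᵥ x := by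
  simp_rw [dotProduct, ← sq]
  have hnonneg : 0 ≤ ∑ i, x i ^ 2 := sum_nonneg fun i _ => sq_nonneg (x i)
  rw [← Real.le_sqrt (norm_nonneg x) hnonneg, pi_norm_le_iff_of_nonneg (Real.sqrt_nonneg _)]
  exact fun i => Real.abs_le_sqrt
    (single_le_sum (f := fun i => x i ^ 2) (fun j _ => sq_nonneg (x j)) (mem_univ i))

theorem exp_neg_mul_dotProduct_self (a : ℝ) (x : d → ℝ) :
    Real.exp (-a * (x ⬝ᵥ x)) = ∏ i, Real.exp (-a * x i ^ 2) := by
  simp_rw [dotProduct, ← sq, mul_sum, Real.exp_sum]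

theorem integrable_exp_neg_mul_dotProduct_mulVec (hS : S.PosDef) {a : ℝ} (ha : 0 < a) :
    Integrable fun x : d → ℝ => Real.exp (-a * (x ⬝ᵥ S *ᵥ x)) := by
  classical
  obtain ⟨B, rfl, hB⟩ := exists_eq_transpose_mul_self hS
  have hdiag : Integrable fun x : d → ℝ => Real.exp (-a * (x ⬝ᵥ x)) := by
    simp_rw [exp_neg_mul_dotProduct_self]
    exact .fintype_prod fun _ => integrable_exp_neg_mul_sq ha
  have hmap : Integrable (fun x => Real.exp (-a * (x ⬝ᵥ x))) (volume.map (toLin' B)) := by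
    rw [Real.map_matrix_volume_pi_eq_smul_volume_pi hB]
    exact hdiag.smul_measure ENNReal.ofReal_ne_top
  simp_rw [dotProduct_transpose_mul_self_mulVec]
  exact hmap.comp_measurable (toLin' B).continuous_of_finiteDimensional.measurable

theorem integral_exp_neg_mul_dotProduct_mulVec [DecidableEq d] (hS : S.PosDef) (a : ℝ) :
    ∫ x : d → ℝ, Real.exp (-a * (x ⬝ᵥ S *ᵥ x)) =
      √(Real.pi / a) ^ Fintype.card d / √S.det := by
  obtain ⟨B, rfl, hB⟩ := exists_eq_transpose_mul_self hS
  have hmeas : Measurable (toLin' B) := (toLin' B).continuous_of_finiteDimensional.measurable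
  have hcont : Continuous fun x : d → ℝ => Real.exp (-a * (x ⬝ᵥ x)) := by
    simp only [dotProduct]; fun_prop
  calc ∫ x : d → ℝ, Real.exp (-a * (x ⬝ᵥ (Bᵀ * B) *ᵥ x))
      = ∫ x, Real.exp (-a * (x ⬝ᵥ x)) ∂(volume.map (toLin' B)) := by
        rw [integral_map hmeas.aemeasurable hcont.aestronglyMeasurable]
        simp_rw [dotProduct_transpose_mul_self_mulVec, toLin'_apply]
    _ = |B.det|⁻¹ * √(Real.pi / a) ^ Fintype.card d := by
        rw [Real.map_matrix_volume_pi_eq_smul_volume_pi hB, integral_smul_measure,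
          ENNReal.toReal_ofReal (abs_nonneg _), abs_inv, smul_eq_mul]
        simp_rw [exp_neg_mul_dotProduct_self]
        rw [integral_fintype_prod_volume_eq_pow fun x : ℝ => Real.exp (-a * x ^ 2),
          integral_gaussian]
    _ = √(Real.pi / a) ^ Fintype.card d / √(Bᵀ * B).det := by
        rw [det_mul, det_transpose, Real.sqrt_mul_self_eq_abs, inv_mul_eq_div]

theorem isBigO_sq_norm_dotProduct_mulVec (hS : S.PosDef) (l : Filter (d → ℝ)) :
    (fun x : d → ℝ => ‖x‖ ^ 2) =O[l] fun x => x ⬝ᵥ S *ᵥ x := by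
  classical
  obtain ⟨B, rfl, hB⟩ := exists_eq_transpose_mul_self hS
  obtain ⟨K, -, hanti⟩ := (mulVecLin B).exists_antilipschitzWith
    (LinearMap.ker_eq_bot.2 (mulVec_injective_of_isUnit ((isUnit_iff_isUnit_det B).2 hB.isUnit)))
  refine .of_bound (K ^ 2) (Eventually.of_forall fun x => ?_)
  have hx : ‖x‖ ≤ K * ‖B *ᵥ x‖ := by simpa using hanti.le_mul_dist x 0
  rw [dotProduct_transpose_mul_self_mulVec, Real.norm_of_nonneg (by positivity)]
  calc ‖x‖ ^ 2 ≤ (K * ‖B *ᵥ x‖) ^ 2 := by gcongr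
    _ ≤ K ^ 2 * ‖B *ᵥ x ⬝ᵥ B *ᵥ x‖ := by
      rw [mul_pow]
      gcongr
      exact (sq_norm_le_dotProduct_self _).trans (le_abs_self _)

end GaussianIntegral

section Taylor

variable {d Ω : Type*} [Fintype d] [MeasurableSpace Ω] {P : Measure Ω} {X : Ω → d → ℤ}

/-- The projection `ℝᵈ → (ℝ/ℤ)ᵈ`. -/
def toTorus (x : d → ℝ) : UnitAddTorus d := fun i => (x i : UnitAddCircle)

theorem mFourier_toTorus (k : d → ℤ) (x : d → ℝ) :
    mFourier k (toTorus x) = Complex.exp ((2 * Real.pi * ∑ i, k i * x i : ℝ) * Complex.I) := by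
  simp only [mFourier, toTorus, ContinuousMap.coe_mk, fourier_coe_apply, ← Complex.exp_sum]
  congr 1
  push_cast
  rw [mul_sum, sum_mul]
  exact sum_congr rfl fun i _ => by ring

theorem norm_exp_mul_I_sub_taylor_le (u : ℝ) :
    ‖Complex.exp (u * Complex.I) - (1 + u * Complex.I - u ^ 2 / 2)‖ ≤
      4 * (u ^ 2 * min 1 |u|) := by
  have htri : ‖Complex.exp (u * Complex.I) - (1 + u * Complex.I - u ^ 2 / 2)‖ ≤
      1 + (1 + |u| + |u| ^ 2 / 2) := by
    calc _ ≤ ‖Complex.exp (u * Complex.I)‖ + (‖(1 : ℂ)‖ + ‖u * Complex.I‖ + ‖(u : ℂ) ^ 2 / 2‖) :=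
          (norm_sub_le _ _).trans (add_le_add_right
            ((norm_sub_le _ _).trans (add_le_add_left (norm_add_le _ _) _)) _)
      _ = 1 + (1 + |u| + |u| ^ 2 / 2) := by simp [Complex.norm_exp_ofReal_mul_I]
  rcases le_total |u| 1 with hu | hu
  · have hexp := Complex.exp_bound (x := u * Complex.I) (by simpa using hu) (n := 3) (by norm_num)
    have hsum : ∑ m ∈ range 3, (u * Complex.I) ^ m / (m.factorial : ℂ) =
        1 + u * Complex.I - u ^ 2 / 2 := by
      simp [sum_range_succ, mul_pow]
      ring
    rw [hsum] at hexp
    rw [min_eq_right hu]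
    refine hexp.trans ?_
    rw [← sq_abs u, ← pow_succ, mul_comm]
    norm_num [Nat.factorial]
    gcongr
    norm_num
  · rw [min_eq_left hu, ← sq_abs u]
    nlinarith

theorem memLp_sum_abs (hL2 : ∀ i, MemLp (fun ω => (X ω i : ℝ)) 2 P) :
    MemLp (fun ω => 2 * Real.pi * ∑ i, |(X ω i : ℝ)|) 2 P :=
  (memLp_finsetSum _ fun i _ => (hL2 i).abs).const_mul _

theorem abs_sum_mul_le (k : d → ℤ) (x : d → ℝ) :
    |2 * Real.pi * ∑ i, k i * x i| ≤ (2 * Real.pi * ∑ i, |(k i : ℝ)|) * ‖x‖ := by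
  rw [abs_mul, abs_of_pos Real.two_pi_pos, mul_assoc _ _ ‖x‖, sum_mul]
  gcongr
  refine (abs_sum_le_sum_abs _ _).trans (sum_le_sum fun i _ => ?_)
  rw [abs_mul]
  gcongr
  exact norm_le_pi_norm x i

theorem integrable_sq_mul_min_one_abs [IsFiniteMeasure P] {Y : Ω → ℝ} (hY : MemLp Y 2 P) (r : ℝ) :
    Integrable (fun ω => Y ω ^ 2 * min 1 |Y ω * r|) P := by
  refine hY.integrable_sq.mul_bdd (c := 1) ?_ (ae_of_all _ fun ω => ?_)
  · exact (continuous_const.min (continuous_id.mul continuous_const).abs).comp_aestronglyMeasurable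
      hY.aestronglyMeasurable
  · rw [Real.norm_of_nonneg (by positivity)]
    exact min_le_left _ _

theorem tendsto_integral_sq_mul_min_one_abs [IsFiniteMeasure P] {Y : Ω → ℝ} (hY : MemLp Y 2 P) :
    Tendsto (fun r : ℝ => ∫ ω, Y ω ^ 2 * min 1 |Y ω * r| ∂P) (𝓝 0) (𝓝 0) := by
  rw [← integral_zero Ω ℝ (μ := P)]
  refine tendsto_integral_filter_of_dominated_convergence (fun ω => Y ω ^ 2)
    (Eventually.of_forall fun r => (integrable_sq_mul_min_one_abs hY r).aestronglyMeasurable)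
    (Eventually.of_forall fun r => ae_of_all _ fun ω => ?_) hY.integrable_sq
    (ae_of_all _ fun ω => ?_)
  · rw [Real.norm_of_nonneg (by positivity)]
    exact mul_le_of_le_one_right (sq_nonneg _) (min_le_left _ _)
  · have hcont : Continuous fun r : ℝ => Y ω ^ 2 * min 1 |Y ω * r| := by fun_prop
    simpa using hcont.tendsto 0

theorem latticeCharFun_toTorus_sub_eq_integral [IsProbabilityMeasure P] (hX : Measurable X)
    (hL2 : ∀ i, MemLp (fun ω => (X ω i : ℝ)) 2 P) (hmean : ∀ i, ∫ ω, (X ω i : ℝ) ∂P = 0)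
    (x : d → ℝ) {u : Ω → ℝ} (hu : ∀ ω, u ω = 2 * Real.pi * ∑ i, X ω i * x i) :
    latticeCharFun P X (toTorus x) -
        (1 - 2 * Real.pi ^ 2 * (∫ ω, (∑ i, X ω i * x i) ^ 2 ∂P : ℝ)) =
      ∫ ω, (Complex.exp (u ω * Complex.I) - (1 + u ω * Complex.I - u ω ^ 2 / 2)) ∂P := by
  have hu_eq := funext hu
  have huL2 : MemLp u 2 P :=
    hu_eq ▸ (memLp_finsetSum _ fun i _ => (hL2 i).mul_const (x i)).const_mul _
  have humean : ∫ ω, u ω ∂P = 0 := by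
    rw [hu_eq, integral_const_mul, integral_finsetSum _ fun i _ =>
      ((hL2 i).integrable one_le_two).mul_const (x i)]
    simp [integral_mul_const, hmean]
  have hexp : Integrable (fun ω => Complex.exp (u ω * Complex.I)) P := by
    simpa only [mFourier_toTorus, hu] using integrable_mFourier_comp hX (toTorus x)
  have hlin : Integrable (fun ω => u ω * Complex.I) P :=
    (huL2.integrable one_le_two).ofReal.mul_const _
  have hone_add : Integrable (fun ω => 1 + u ω * Complex.I) P := (integrable_const 1).add hlin
  have hsq : Integrable (fun ω => ((u ω ^ 2 / 2 : ℝ) : ℂ)) P :=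
    (huL2.integrable_sq.div_const 2).ofReal
  have hquad : Integrable (fun ω => 1 + u ω * Complex.I - (u ω ^ 2 / 2 : ℝ)) P := hone_add.sub hsq
  simp_rw [← Complex.ofReal_pow, ← Complex.ofReal_ofNat, ← Complex.ofReal_div]
  rw [integral_sub hexp hquad, integral_sub hone_add hsq,
    integral_add (integrable_const 1) hlin, integral_mul_const, integral_complex_ofReal,
    integral_complex_ofReal, humean]
  simp only [latticeCharFun, mFourier_toTorus, hu, integral_div, mul_pow, integral_const_mul,
    integral_const, probReal_univ, one_smul]
  push_cast
  ring

theorem norm_latticeCharFun_toTorus_sub_le [IsProbabilityMeasure P] (hX : Measurable X)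
    (hL2 : ∀ i, MemLp (fun ω => (X ω i : ℝ)) 2 P) (hmean : ∀ i, ∫ ω, (X ω i : ℝ) ∂P = 0)
    (x : d → ℝ) {Y : Ω → ℝ} (hY : ∀ ω, Y ω = 2 * Real.pi * ∑ i, |(X ω i : ℝ)|) :
    ‖latticeCharFun P X (toTorus x) -
        (1 - 2 * Real.pi ^ 2 * (∫ ω, (∑ i, X ω i * x i) ^ 2 ∂P : ℝ))‖ ≤
      4 * ‖x‖ ^ 2 * ∫ ω, Y ω ^ 2 * min 1 |Y ω * ‖x‖| ∂P := by
  obtain rfl : Y = fun ω => 2 * Real.pi * ∑ i, |(X ω i : ℝ)| := funext hY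
  rw [latticeCharFun_toTorus_sub_eq_integral hX hL2 hmean x fun _ => rfl, ← integral_const_mul]
  refine norm_integral_le_of_norm_le
    ((integrable_sq_mul_min_one_abs (memLp_sum_abs hL2) _).const_mul _) (ae_of_all _ fun ω => ?_)
  refine (norm_exp_mul_I_sub_taylor_le _).trans ?_
  rw [← sq_abs, mul_assoc 4, ← mul_assoc (‖x‖ ^ 2), mul_comm (‖x‖ ^ 2), ← mul_pow,
    ← sq_abs (_ * ‖x‖)]
  have hle := (abs_sum_mul_le (X ω) x).trans (le_abs_self _)
  gcongr

theorem isLittleO_latticeCharFun_toTorus_sub [IsProbabilityMeasure P] (hX : Measurable X)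
    (hL2 : ∀ i, MemLp (fun ω => (X ω i : ℝ)) 2 P) (hmean : ∀ i, ∫ ω, (X ω i : ℝ) ∂P = 0) :
    (fun x => latticeCharFun P X (toTorus x) -
        (1 - 2 * Real.pi ^ 2 * (∫ ω, (∑ i, X ω i * x i) ^ 2 ∂P : ℝ))) =o[𝓝 0]
      fun x => ‖x‖ ^ 2 := by
  have hlim := ((tendsto_integral_sq_mul_min_one_abs (memLp_sum_abs hL2)).comp
    (tendsto_norm_zero (E := d → ℝ))).const_mul 4
  rw [mul_zero] at hlim
  refine Asymptotics.isLittleO_iff.2 fun c hc => ?_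
  filter_upwards [hlim.eventually_le_const hc] with x hx
  refine (norm_latticeCharFun_toTorus_sub_le hX hL2 hmean x fun _ => rfl).trans ?_
  rw [Real.norm_of_nonneg (by positivity), mul_right_comm]
  gcongr
  exact hx

end Taylor

section Covariance

open Matrix
open scoped MatrixOrder

variable {Ω : Type*} [MeasurableSpace Ω] {P : Measure Ω} {X : Ω → Fin 2 → ℤ}

theorem dotProduct_covMatrix_mulVec [IsFiniteMeasure P]
    (hL2 : ∀ i, MemLp (fun ω => (X ω i : ℝ)) 2 P) (x : Fin 2 → ℝ) :
    x ⬝ᵥ covMatrix P X *ᵥ x = Var[fun ω => ∑ i, X ω i * x i; P] := by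
  have hL2' : ∀ i, MemLp (fun ω => X ω i * x i) 2 P := fun i => (hL2 i).mul_const (x i)
  rw [← covariance_self (memLp_finsetSum _ fun i _ => hL2' i).aemeasurable,
    covariance_fun_sum_fun_sum hL2' hL2']
  simp only [dotProduct, mulVec, covMatrix, of_apply, covariance_mul_const_left,
    covariance_mul_const_right, mul_sum]
  exact sum_congr rfl fun i _ => sum_congr rfl fun j _ => by ring

theorem posDef_covMatrix [IsFiniteMeasure P] (hL2 : ∀ i, MemLp (fun ω => (X ω i : ℝ)) 2 P)
    (hdet : (covMatrix P X).det ≠ 0) : (covMatrix P X).PosDef := by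
  refine (PosSemidef.of_dotProduct_mulVec_nonneg ?_ fun x => ?_).posDef_iff_det_ne_zero.2 hdet
  · ext i j
    simp [covMatrix, covariance_comm]
  · rw [star_trivial, dotProduct_covMatrix_mulVec hL2]
    exact variance_nonneg _ _

theorem isLittleO_latticeCharFun_toTorus_sub_covMatrix [IsProbabilityMeasure P]
    (hX : Measurable X) (hL2 : ∀ i, MemLp (fun ω => (X ω i : ℝ)) 2 P)
    (hmean : ∀ i, ∫ ω, (X ω i : ℝ) ∂P = 0) (hdet : (covMatrix P X).det ≠ 0) :
    (fun x => latticeCharFun P X (toTorus x) -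
        (1 - 2 * Real.pi ^ 2 * (x ⬝ᵥ covMatrix P X *ᵥ x : ℝ))) =o[𝓝 0]
      fun x => x ⬝ᵥ covMatrix P X *ᵥ x := by
  refine .trans_isBigO (.congr_left (isLittleO_latticeCharFun_toTorus_sub hX hL2 hmean) fun x => ?_)
    (isBigO_sq_norm_dotProduct_mulVec (posDef_covMatrix hL2 hdet) _)
  rw [dotProduct_covMatrix_mulVec hL2, variance_of_integral_eq_zero]
  · exact (memLp_finsetSum _ fun i _ => (hL2 i).mul_const (x i)).aemeasurable
  · rw [integral_finsetSum _ fun i _ => ((hL2 i).integrable one_le_two).mul_const (x i)]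
    simp [integral_mul_const, hmean]

end Covariance

section LocalLimit

open Matrix Metric

variable {d : Type*} [Fintype d] {S : Matrix d d ℝ} {F G : (d → ℝ) → ℂ} {δ : ℝ}

theorem continuous_dotProduct_mulVec (S : Matrix d d ℝ) : Continuous fun x => x ⬝ᵥ S *ᵥ x :=
  continuous_id.dotProduct (continuous_const.matrix_mulVec continuous_id)

theorem dotProduct_mulVec_smul (S : Matrix d d ℝ) (c : ℝ) (x : d → ℝ) :
    (c • x) ⬝ᵥ S *ᵥ (c • x) = c ^ 2 * (x ⬝ᵥ S *ᵥ x) := by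
  rw [mulVec_smul, dotProduct_smul, smul_dotProduct, smul_eq_mul, smul_eq_mul, ← mul_assoc, sq]

theorem eventually_norm_le_exp_neg (hS : S.PosDef)
    (hF : (fun x => F x - (1 - 2 * Real.pi ^ 2 * (x ⬝ᵥ S *ᵥ x : ℝ))) =o[𝓝 0]
      fun x => x ⬝ᵥ S *ᵥ x) :
    ∀ᶠ x in 𝓝 0, ‖F x‖ ≤ Real.exp (-(x ⬝ᵥ S *ᵥ x)) := by
  have hsmall : ∀ᶠ x : d → ℝ in 𝓝 0, 2 * Real.pi ^ 2 * (x ⬝ᵥ S *ᵥ x) < 1 :=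
    ((continuous_dotProduct_mulVec S).const_mul _).tendsto' 0 0 (by simp) |>.eventually_lt_const
      one_pos
  filter_upwards [hsmall, Asymptotics.isLittleO_iff.1 hF one_pos] with x hx hFx
  have hQ : 0 ≤ x ⬝ᵥ S *ᵥ x := by simpa using hS.posSemidef.dotProduct_mulVec_nonneg x
  rw [Real.norm_of_nonneg hQ, one_mul] at hFx
  have hmain : ‖(1 - 2 * Real.pi ^ 2 * (x ⬝ᵥ S *ᵥ x : ℝ) : ℂ)‖ =
      1 - 2 * Real.pi ^ 2 * (x ⬝ᵥ S *ᵥ x) := by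
    rw [← Real.norm_of_nonneg (sub_nonneg.2 hx.le), ← Complex.norm_real]
    push_cast
    rfl
  calc ‖F x‖ ≤ x ⬝ᵥ S *ᵥ x + (1 - 2 * Real.pi ^ 2 * (x ⬝ᵥ S *ᵥ x)) := by
        rw [← hmain]
        exact (norm_le_norm_sub_add _ _).trans (by gcongr)
    _ ≤ 1 - x ⬝ᵥ S *ᵥ x := by
        have hpi : 1 ≤ Real.pi ^ 2 := one_le_pow₀ (by linarith [Real.pi_gt_three])
        linarith [mul_le_mul_of_nonneg_right hpi hQ]
    _ ≤ Real.exp (-(x ⬝ᵥ S *ᵥ x)) := Real.one_sub_le_exp_neg _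

theorem natCast_mul_dotProduct_mulVec_inv_sqrt_smul (S : Matrix d d ℝ) {m : ℕ} (hm : m ≠ 0)
    (y : d → ℝ) : (m : ℝ) * (((√m)⁻¹ • y) ⬝ᵥ S *ᵥ ((√m)⁻¹ • y)) = y ⬝ᵥ S *ᵥ y := by
  rw [dotProduct_mulVec_smul, inv_pow, Real.sq_sqrt m.cast_nonneg, ← mul_assoc,
    mul_inv_cancel₀ (by positivity), one_mul]

theorem tendsto_pow_inv_sqrt_smul
    (hF : (fun x => F x - (1 - 2 * Real.pi ^ 2 * (x ⬝ᵥ S *ᵥ x : ℝ))) =o[𝓝 0]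
      fun x => x ⬝ᵥ S *ᵥ x) (y : d → ℝ) :
    Tendsto (fun m : ℕ => F ((√m)⁻¹ • y) ^ m) atTop
      (𝓝 (Real.exp (-(2 * Real.pi ^ 2) * (y ⬝ᵥ S *ᵥ y)))) := by
  have hscale : Tendsto (fun m : ℕ => (√m)⁻¹) atTop (𝓝 0) :=
    (Real.tendsto_sqrt_atTop.comp tendsto_natCast_atTop_atTop).inv_tendsto_atTop
  have hQ : Tendsto (fun m : ℕ => (m : ℝ) • (((√m)⁻¹ • y) ⬝ᵥ S *ᵥ ((√m)⁻¹ • y))) atTop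
      (𝓝 (y ⬝ᵥ S *ᵥ y)) := by
    refine tendsto_const_nhds.congr' ?_
    filter_upwards [eventually_gt_atTop 0] with m hm
    exact (natCast_mul_dotProduct_mulVec_inv_sqrt_smul S hm.ne' y).symm
  have herr := (Asymptotics.isBigO_refl (fun m : ℕ => (m : ℝ)) atTop).smul_isLittleO
    (hF.comp_tendsto (by simpa using hscale.smul_const y))
  have hlim := ((Asymptotics.isLittleO_one_iff ℝ).1 (herr.trans_isBigO (hQ.isBigO_one ℝ))).add
    ((hQ.const_mul (-(2 * Real.pi ^ 2))).ofReal)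
  rw [zero_add] at hlim
  rw [Complex.ofReal_exp]
  refine (Complex.tendsto_one_add_pow_exp_of_tendsto
    (g := fun m => F ((√m)⁻¹ • y) - 1) (hlim.congr fun m => ?_)).congr fun m => ?_
  · simp only [Function.comp_apply, Complex.real_smul, smul_eq_mul]
    push_cast
    ring
  · rw [add_sub_cancel]

theorem tendsto_sqrt_pow_mul_setIntegral_pow (hS : S.PosDef)
    (hF : (fun x => F x - (1 - 2 * Real.pi ^ 2 * (x ⬝ᵥ S *ᵥ x : ℝ))) =o[𝓝 0]
      fun x => x ⬝ᵥ S *ᵥ x)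
    (hFcont : Continuous F) (hFle : ∀ x ∈ closedBall 0 δ, ‖F x‖ ≤ Real.exp (-(x ⬝ᵥ S *ᵥ x)))
    (hδ : 0 < δ) (hGcont : Continuous G) (hGle : ∀ x, ‖G x‖ ≤ 1) :
    Tendsto (fun m : ℕ => (√m ^ Fintype.card d) • ∫ x in closedBall 0 δ, F x ^ m * G x) atTop
      (𝓝 (∫ y, Real.exp (-(2 * Real.pi ^ 2) * (y ⬝ᵥ S *ᵥ y)) * G 0)) := by
  have hscale : Tendsto (fun m : ℕ => (√m)⁻¹) atTop (𝓝 0) :=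
    (Real.tendsto_sqrt_atTop.comp tendsto_natCast_atTop_atTop).inv_tendsto_atTop
  have hmem : ∀ y : d → ℝ, ∀ᶠ m : ℕ in atTop, (√m)⁻¹ • y ∈ closedBall (0 : d → ℝ) δ := fun y =>
    (show Tendsto (fun m : ℕ => (√m)⁻¹ • y) atTop (𝓝 0) by
      simpa using hscale.smul_const y) (closedBall_mem_nhds 0 hδ)
  have hsubst : ∀ᶠ m : ℕ in atTop, ∫ y, (closedBall 0 δ).indicator (fun x => F x ^ m * G x)
      ((√m)⁻¹ • y) = (√m ^ Fintype.card d) • ∫ x in closedBall 0 δ, F x ^ m * G x := by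
    filter_upwards [eventually_gt_atTop 0] with m hm
    rw [Measure.integral_comp_inv_smul, integral_indicator measurableSet_closedBall,
      Module.finrank_pi, abs_of_nonneg (by positivity)]
  refine Tendsto.congr' hsubst (tendsto_integral_filter_of_dominated_convergence
    (fun y => Real.exp (-1 * (y ⬝ᵥ S *ᵥ y))) ?_ ?_
    (integrable_exp_neg_mul_dotProduct_mulVec hS one_pos) (ae_of_all _ fun y => ?_))
  · exact Eventually.of_forall fun m => (((hFcont.pow m).mul hGcont).measurable.indicator
      measurableSet_closedBall |>.comp (measurable_const_smul _)).aestronglyMeasurable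
  · filter_upwards [eventually_gt_atTop 0] with m hm
    refine ae_of_all _ fun y => ?_
    by_cases hy : (√m)⁻¹ • y ∈ closedBall (0 : d → ℝ) δ
    · rw [Set.indicator_of_mem hy, norm_mul, norm_pow, neg_one_mul,
        ← natCast_mul_dotProduct_mulVec_inv_sqrt_smul S hm.ne' y, ← mul_neg, Real.exp_nat_mul,
        ← mul_one (Real.exp _ ^ m)]
      exact mul_le_mul (pow_le_pow_left₀ (norm_nonneg _) (hFle _ hy) m) (hGle _) (norm_nonneg _)
        (by positivity)
    · rw [Set.indicator_of_notMem hy, norm_zero]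
      positivity
  · refine Tendsto.congr' ?_ ((tendsto_pow_inv_sqrt_smul hF y).mul
      ((hGcont.tendsto 0).comp (by simpa using hscale.smul_const y)))
    filter_upwards [hmem y] with m hm
    rw [Set.indicator_of_mem hm]
    rfl

end LocalLimit

section TorusNeighbourhood

open Metric

theorem continuous_toTorus {d : Type*} : Continuous (toTorus : (d → ℝ) → UnitAddTorus d) :=
  continuous_pi fun i => (AddCircle.continuous_mk' 1).comp (continuous_apply i)

variable {d : Type*} [Fintype d]

theorem norm_toTorus {x : d → ℝ} (hx : ‖x‖ ≤ 1 / 2) : ‖toTorus x‖ = ‖x‖ := by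
  have hcoord : ∀ i, ‖toTorus x i‖₊ = ‖x i‖₊ := fun i =>
    NNReal.eq <| (AddCircle.norm_coe_eq_abs_iff 1 one_ne_zero).2 <| by
      rw [abs_one]
      exact (norm_le_pi_norm x i).trans hx
  simp only [Pi.norm_def, hcoord]

theorem setIntegral_closedBall_torusHaar {E : Type*} [NormedAddCommGroup E] [NormedSpace ℝ E]
    (f : UnitAddTorus (Fin 2) → E) {δ : ℝ} (hδ : δ < 1 / 2) :
    ∫ t in closedBall 0 δ, f t ∂torusHaar = ∫ x in closedBall 0 δ, f (toTorus x) := by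
  have hcube : MeasurableSet {x : Fin 2 → ℝ | ∀ i, x i ∈ Set.Ioc (-(1 / 2) : ℝ) (-(1 / 2) + 1)} :=
    MeasurableSet.univ_pi' fun _ => measurableSet_Ioc
  have hsub : closedBall (0 : Fin 2 → ℝ) δ ⊆
      {x | ∀ i, x i ∈ Set.Ioc (-(1 / 2) : ℝ) (-(1 / 2) + 1)} := by
    intro x hx i
    have hxi := abs_le.1 ((norm_le_pi_norm x i).trans (mem_closedBall_zero_iff.1 hx))
    constructor <;> linarith [hxi.1, hxi.2]
  rw [← integral_indicator measurableSet_closedBall, ← Set.inter_eq_self_of_subset_right hsub,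
    ← setIntegral_indicator measurableSet_closedBall]
  refine (integral_preimage ((closedBall 0 δ).indicator f) fun _ => -(1 / 2 : ℝ)).trans
    (setIntegral_congr_fun hcube fun x hx => ?_)
  have hnorm : ‖toTorus x‖ = ‖x‖ := norm_toTorus <| (pi_norm_le_iff_of_nonneg (by norm_num)).2
    fun i => abs_le.2 ⟨(hx i).1.le, (hx i).2.trans (by norm_num)⟩
  simp only [Set.indicator, mem_closedBall_zero_iff, ← hnorm]
  rfl

end TorusNeighbourhood

section Cesaro

variable {E : Type*} [NormedAddCommGroup E] [NormedSpace ℝ E]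

theorem tendsto_inv_smul_sum_range {u : ℕ → E} {v w : ℕ → ℝ} {c : E} (hv : 0 ≤ v)
    (hw : Tendsto w atTop atTop)
    (hvw : Tendsto (fun n => (w n)⁻¹ * ∑ m ∈ range n, v m) atTop (𝓝 1))
    (h : (fun n => u n - v n • c) =o[atTop] v) :
    Tendsto (fun n => (w n)⁻¹ • ∑ m ∈ range n, u m) atTop (𝓝 c) := by
  have hsum : Tendsto (fun n => ∑ m ∈ range n, v m) atTop atTop := by
    refine (hw.atTop_mul_pos one_pos hvw).congr' ?_
    filter_upwards [hw.eventually_ne_atTop 0] with n hn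
    rw [mul_inv_cancel_left₀ hn]
  have herr : Tendsto (fun n => (w n)⁻¹ • ∑ m ∈ range n, (u m - v m • c)) atTop (𝓝 0) :=
    (Asymptotics.isLittleO_one_iff ℝ).1 <| ((Asymptotics.isBigO_refl (fun n => (w n)⁻¹) _)
      |>.smul_isLittleO (h.sum_range hv hsum)).trans_isBigO (hvw.isBigO_one ℝ)
  have hlim := herr.add (hvw.smul_const c)
  rw [zero_add, one_smul] at hlim
  refine hlim.congr fun n => ?_
  rw [sum_sub_distrib, ← sum_smul, smul_sub, smul_smul, sub_add_cancel]

theorem tendsto_log_natCast_atTop : Tendsto (fun n : ℕ => Real.log n) atTop atTop :=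
  Real.tendsto_log_atTop.comp tendsto_natCast_atTop_atTop

theorem tendsto_inv_log_mul_sum_inv :
    Tendsto (fun n : ℕ => (Real.log n)⁻¹ * ∑ m ∈ range n, (m : ℝ)⁻¹) atTop (𝓝 1) := by
  have hsum : Tendsto (fun n : ℕ => ∑ m ∈ range n, (m : ℝ)⁻¹ - Real.log n) atTop
      (𝓝 Real.eulerMascheroniConstant) := by
    have hlim := Real.tendsto_harmonic_sub_log.sub (tendsto_inv_atTop_nhds_zero_nat (𝕜 := ℝ))
    rw [sub_zero] at hlim
    refine hlim.congr fun n => ?_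
    have hharmonic : (harmonic n : ℝ) = ∑ m ∈ range (n + 1), (m : ℝ)⁻¹ := by
      rw [sum_range_succ', harmonic]
      push_cast
      rw [inv_zero, add_zero]
    rw [hharmonic, sum_range_succ]
    ring
  have hlim := (tendsto_log_natCast_atTop.inv_tendsto_atTop.mul hsum).add_const 1
  rw [zero_mul, zero_add] at hlim
  refine hlim.congr' ?_
  filter_upwards [tendsto_log_natCast_atTop.eventually_ne_atTop 0] with n hn
  rw [Pi.inv_apply, mul_sub, inv_mul_cancel₀ hn, sub_add_cancel]

theorem tendsto_inv_mul_log_mul_sum_log :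
    Tendsto (fun n : ℕ => (n * Real.log n)⁻¹ * ∑ m ∈ range n, Real.log m) atTop (𝓝 1) := by
  have hfact : ∀ n : ℕ, ∑ m ∈ range n, Real.log m + Real.log n = Real.log n.factorial := by
    intro n
    induction n with
    | zero => simp
    | succ n ih =>
      rw [sum_range_succ, ih, Nat.factorial_succ, Nat.cast_mul,
        Real.log_mul (by positivity) (by positivity), add_comm]
  have hlower : Tendsto (fun n : ℕ => 1 - (Real.log n)⁻¹ - (n : ℝ)⁻¹) atTop (𝓝 1) := by
    simpa using (tendsto_log_natCast_atTop.inv_tendsto_atTop.const_sub 1).sub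
      (tendsto_inv_atTop_nhds_zero_nat (𝕜 := ℝ))
  refine tendsto_of_tendsto_of_tendsto_of_le_of_le' hlower tendsto_const_nhds ?_ ?_
  · filter_upwards [tendsto_log_natCast_atTop.eventually_gt_atTop 0, eventually_gt_atTop 0]
      with n hlog hn
    have hn' : (0 : ℝ) < n := Nat.cast_pos.2 hn
    have hstirling := Stirling.le_log_factorial_stirling hn.ne'
    have hpi : 0 ≤ Real.log (2 * Real.pi) := Real.log_nonneg (by linarith [Real.pi_gt_three])
    rw [← hfact] at hstirling
    rw [inv_mul_eq_div, le_div_iff₀ (mul_pos hn' hlog)]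
    calc (1 - (Real.log n)⁻¹ - (n : ℝ)⁻¹) * (n * Real.log n)
        = n * Real.log n - n - Real.log n := by field_simp
      _ ≤ ∑ m ∈ range n, Real.log m := by linarith
  · filter_upwards [tendsto_log_natCast_atTop.eventually_gt_atTop 0, eventually_gt_atTop 0]
      with n hlog hn
    rw [inv_mul_le_one₀ (mul_pos (Nat.cast_pos.2 hn) hlog)]
    calc ∑ m ∈ range n, Real.log m ≤ #(range n) • Real.log n := by
          refine sum_le_card_nsmul _ _ _ fun m hm => ?_
          rcases m.eq_zero_or_pos with rfl | hm0
          · simpa using hlog.le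
          · exact Real.log_le_log (Nat.cast_pos.2 hm0)
              (Nat.cast_le.2 (mem_range.1 hm).le)
      _ = n * Real.log n := by rw [card_range, nsmul_eq_mul]

end Cesaro

section GeometricSum

theorem norm_geom_sum_le {z : ℂ} {c : ℝ} (hz : ‖z‖ ≤ 1) (hc : 0 < c) (h : c ≤ ‖1 - z‖) (n : ℕ) :
    ‖∑ m ∈ range n, z ^ m‖ ≤ 2 / c := by
  rw [le_div_iff₀ hc]
  calc ‖∑ m ∈ range n, z ^ m‖ * c ≤ ‖∑ m ∈ range n, z ^ m‖ * ‖1 - z‖ := by gcongr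
    _ = ‖1 - z ^ n‖ := by rw [← norm_mul, geom_sum_mul_neg]
    _ ≤ ‖(1 : ℂ)‖ + ‖z ^ n‖ := norm_sub_le _ _
    _ ≤ 2 := by
      rw [norm_one, norm_pow]
      linarith [pow_le_one₀ (n := n) (norm_nonneg z) hz]

theorem norm_geom_sum_sq_le (z : ℂ) (n : ℕ) :
    ‖∑ m ∈ range n, z ^ m‖ ^ 2 ≤ ∑ i ∈ range n, ∑ j ∈ range n, ‖z‖ ^ (i + j) := by
  calc ‖∑ m ∈ range n, z ^ m‖ ^ 2 ≤ (∑ m ∈ range n, ‖z‖ ^ m) ^ 2 := by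
        gcongr
        exact (norm_sum_le _ _).trans_eq (sum_congr rfl fun m _ => norm_pow z m)
    _ = ∑ i ∈ range n, ∑ j ∈ range n, ‖z‖ ^ (i + j) := by
        simp only [sq, sum_mul_sum, pow_add]

theorem sum_sum_inv_add_add_one_le (n : ℕ) :
    ∑ i ∈ range n, ∑ j ∈ range n, ((i + j : ℕ) + 1 : ℝ)⁻¹ ≤ 3 * n := by
  induction n with
  | zero => simp
  | succ n ih =>
    have hrow : ∑ i ∈ range n, ((i + n : ℕ) + 1 : ℝ)⁻¹ ≤ 1 :=
      calc ∑ i ∈ range n, ((i + n : ℕ) + 1 : ℝ)⁻¹ ≤ #(range n) • (n + 1 : ℝ)⁻¹ := by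
            refine sum_le_card_nsmul _ _ _ fun i _ => ?_
            gcongr
            exact n.le_add_left i
        _ ≤ 1 := by
            rw [card_range, nsmul_eq_mul, ← div_eq_mul_inv]
            exact div_le_one_of_le₀ (by linarith) (by positivity)
    have hcol : ∑ j ∈ range n, ((n + j : ℕ) + 1 : ℝ)⁻¹ ≤ 1 := by simpa only [add_comm] using hrow
    have hcorner : ((n + n : ℕ) + 1 : ℝ)⁻¹ ≤ 1 := inv_le_one_of_one_le₀ (by simp)
    simp only [sum_range_succ _ n, sum_add_distrib]
    push_cast at *
    linarith

end GeometricSum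

section TorusPowers

open Matrix Metric

theorem exists_norm_le_exp_neg_on_closedBall {d : Type*} [Fintype d] {S : Matrix d d ℝ}
    {F : (d → ℝ) → ℂ} (hS : S.PosDef)
    (hF : (fun x => F x - (1 - 2 * Real.pi ^ 2 * (x ⬝ᵥ S *ᵥ x : ℝ))) =o[𝓝 0]
      fun x => x ⬝ᵥ S *ᵥ x) :
    ∃ δ, 0 < δ ∧ δ < 1 / 2 ∧ ∀ x ∈ closedBall 0 δ,
      x ⬝ᵥ S *ᵥ x ≤ 1 ∧ ‖F x‖ ≤ Real.exp (-(x ⬝ᵥ S *ᵥ x)) := by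
  have hsmall : ∀ᶠ x : d → ℝ in 𝓝 0, x ⬝ᵥ S *ᵥ x ≤ 1 :=
    (continuous_dotProduct_mulVec S).tendsto' 0 0 (by simp) |>.eventually_le_const one_pos
  obtain ⟨ε, hε, hball⟩ := Metric.eventually_nhds_iff_ball.1
    (hsmall.and (eventually_norm_le_exp_neg hS hF))
  refine ⟨min (ε / 2) (1 / 4), by positivity, (min_le_right _ _).trans_lt (by norm_num),
    fun x hx => hball x (closedBall_subset_ball ?_ hx)⟩
  exact (min_le_left _ _).trans_lt (half_lt_self hε)

variable {S : Matrix (Fin 2) (Fin 2) ℝ} {χ : UnitAddTorus (Fin 2) → ℂ}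

theorem setIntegral_norm_pow_le {F : (Fin 2 → ℝ) → ℂ} {δ : ℝ} (hS : S.PosDef)
    (hFcont : Continuous F) (hF : ∀ x ∈ closedBall 0 δ,
      x ⬝ᵥ S *ᵥ x ≤ 1 ∧ ‖F x‖ ≤ Real.exp (-(x ⬝ᵥ S *ᵥ x))) (k : ℕ) :
    ∫ x in closedBall 0 δ, ‖F x‖ ^ k ≤
      Real.exp 1 * (Real.pi / √S.det) * (k + 1 : ℝ)⁻¹ := by
  have hk : (0 : ℝ) < k + 1 := by positivity
  have hint : Integrable fun x : Fin 2 → ℝ =>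
      Real.exp 1 * Real.exp (-(k + 1 : ℝ) * (x ⬝ᵥ S *ᵥ x)) :=
    (integrable_exp_neg_mul_dotProduct_mulVec hS hk).const_mul _
  calc ∫ x in closedBall 0 δ, ‖F x‖ ^ k
      ≤ ∫ x in closedBall 0 δ, Real.exp 1 * Real.exp (-(k + 1 : ℝ) * (x ⬝ᵥ S *ᵥ x)) := by
        refine setIntegral_mono_on ((hFcont.norm.pow k).continuousOn.integrableOn_compact
          (isCompact_closedBall 0 δ)) hint.integrableOn measurableSet_closedBall fun x hx => ?_
        obtain ⟨hQ, hFx⟩ := hF x hx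
        calc ‖F x‖ ^ k ≤ Real.exp (-(x ⬝ᵥ S *ᵥ x)) ^ k := pow_le_pow_left₀ (norm_nonneg _) hFx k
          _ = Real.exp (k * -(x ⬝ᵥ S *ᵥ x)) := (Real.exp_nat_mul _ _).symm
          _ ≤ Real.exp (1 + -(k + 1 : ℝ) * (x ⬝ᵥ S *ᵥ x)) := Real.exp_le_exp.2 (by linarith)
          _ = _ := Real.exp_add _ _
    _ ≤ ∫ x : Fin 2 → ℝ, Real.exp 1 * Real.exp (-(k + 1 : ℝ) * (x ⬝ᵥ S *ᵥ x)) :=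
        setIntegral_le_integral hint (ae_of_all _ fun x => by positivity)
    _ = Real.exp 1 * (Real.pi / √S.det) * (k + 1 : ℝ)⁻¹ := by
        rw [integral_const_mul, integral_exp_neg_mul_dotProduct_mulVec hS, Fintype.card_fin,
          Real.sq_sqrt (by positivity)]
        ring

theorem tendsto_mul_setIntegral_pow_mul {δ : ℝ} (hS : S.PosDef) (hχ : Continuous χ)
    (hloc : (fun x => χ (toTorus x) - (1 - 2 * Real.pi ^ 2 * (x ⬝ᵥ S *ᵥ x : ℝ))) =o[𝓝 0]
      fun x => x ⬝ᵥ S *ᵥ x) (hδ0 : 0 < δ) (hδ : δ < 1 / 2)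
    (hnear : ∀ x ∈ closedBall 0 δ, ‖χ (toTorus x)‖ ≤ Real.exp (-(x ⬝ᵥ S *ᵥ x)))
    (l : Fin 2 → ℤ) :
    Tendsto (fun m : ℕ => (m : ℝ) • ∫ t in closedBall 0 δ, mFourier (-l) t * χ t ^ m ∂torusHaar)
      atTop (𝓝 ((2 * Real.pi * √S.det)⁻¹ : ℝ)) := by
  have hlim := tendsto_sqrt_pow_mul_setIntegral_pow hS hloc (hχ.comp continuous_toTorus) hnear hδ0
    ((map_continuous (mFourier (-l))).comp continuous_toTorus) fun x => (norm_mFourier_apply _ _).le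
  have hzero : mFourier (-l) (toTorus 0) = 1 := mFourier_apply_zero (-l)
  have hgauss : ∫ y : Fin 2 → ℝ, (Real.exp (-(2 * Real.pi ^ 2) * (y ⬝ᵥ S *ᵥ y)) : ℂ) =
      ((2 * Real.pi * √S.det)⁻¹ : ℝ) := by
    rw [integral_complex_ofReal, integral_exp_neg_mul_dotProduct_mulVec hS, Fintype.card_fin,
      Real.sq_sqrt (by positivity)]
    congr 1
    field_simp
  simp only [Function.comp_apply, hzero, mul_one, hgauss, Fintype.card_fin] at hlim
  refine hlim.congr fun m => ?_
  rw [Real.sq_sqrt m.cast_nonneg, setIntegral_closedBall_torusHaar _ hδ]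
  simp only [mul_comm]

theorem tendsto_inv_log_smul_sum_setIntegral_pow {δ : ℝ} (hS : S.PosDef) (hχ : Continuous χ)
    (hloc : (fun x => χ (toTorus x) - (1 - 2 * Real.pi ^ 2 * (x ⬝ᵥ S *ᵥ x : ℝ))) =o[𝓝 0]
      fun x => x ⬝ᵥ S *ᵥ x) (hδ0 : 0 < δ) (hδ : δ < 1 / 2)
    (hnear : ∀ x ∈ closedBall 0 δ, ‖χ (toTorus x)‖ ≤ Real.exp (-(x ⬝ᵥ S *ᵥ x)))
    (l : Fin 2 → ℤ) :
    Tendsto (fun n : ℕ => (Real.log n)⁻¹ • ∑ m ∈ range n,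
      ∫ t in closedBall 0 δ, mFourier (-l) t * χ t ^ m ∂torusHaar)
      atTop (𝓝 ((2 * Real.pi * √S.det)⁻¹ : ℝ)) := by
  have hlim := tendsto_sub_nhds_zero_iff.2
    (tendsto_mul_setIntegral_pow_mul hS hχ hloc hδ0 hδ hnear l)
  refine tendsto_inv_smul_sum_range (fun m => by positivity) tendsto_log_natCast_atTop
    tendsto_inv_log_mul_sum_inv ?_
  refine (((Asymptotics.isBigO_refl (fun m : ℕ => (m : ℝ)⁻¹) atTop).smul_isLittleO
    ((Asymptotics.isLittleO_one_iff ℝ).2 hlim)).congr' ?_ ?_)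
  · filter_upwards [eventually_ne_atTop 0] with m hm
    rw [smul_sub, inv_smul_smul₀ (Nat.cast_ne_zero.2 hm)]
  · exact Eventually.of_forall fun m => mul_one _

theorem tendsto_inv_log_smul_mFourierCoeff_sum_pow (hS : S.PosDef) (hχ : Continuous χ)
    (hχ1 : ∀ t, ‖χ t‖ ≤ 1)
    (hloc : (fun x => χ (toTorus x) - (1 - 2 * Real.pi ^ 2 * (x ⬝ᵥ S *ᵥ x : ℝ))) =o[𝓝 0]
      fun x => x ⬝ᵥ S *ᵥ x)
    (hfar : ∀ U ∈ 𝓝 0, ∃ c > 0, ∀ t ∉ U, c ≤ ‖1 - χ t‖) (l : Fin 2 → ℤ) :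
    Tendsto (fun n : ℕ => (Real.log n)⁻¹ • mFourierCoeff (fun t => ∑ m ∈ range n, χ t ^ m) l)
      atTop (𝓝 ((2 * Real.pi * √S.det)⁻¹ : ℝ)) := by
  obtain ⟨δ, hδ0, hδ, hnear⟩ := exists_norm_le_exp_neg_on_closedBall hS hloc
  obtain ⟨c, hc, hfar⟩ := hfar _ (closedBall_mem_nhds 0 hδ0)
  have hsplit : ∀ n : ℕ, mFourierCoeff (fun t => ∑ m ∈ range n, χ t ^ m) l =
      ∑ m ∈ range n, ∫ t in closedBall 0 δ, mFourier (-l) t * χ t ^ m ∂torusHaar +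
        ∫ t in (closedBall 0 δ)ᶜ, mFourier (-l) t * ∑ m ∈ range n, χ t ^ m ∂torusHaar := by
    intro n
    have hterm : ∀ m : ℕ, Integrable (fun t => mFourier (-l) t * χ t ^ m) torusHaar := fun m =>
      integrable_of_continuous (by fun_prop)
    rw [← integral_finsetSum _ fun m _ => (hterm m).integrableOn]
    simp only [← mul_sum]
    rw [integral_add_compl measurableSet_closedBall (integrable_of_continuous (by fun_prop))]
    rfl
  have hcompl : ∀ n : ℕ, ‖∫ t in (closedBall 0 δ)ᶜ,
      mFourier (-l) t * ∑ m ∈ range n, χ t ^ m ∂torusHaar‖ ≤ 2 / c := by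
    intro n
    refine (norm_setIntegral_le_of_norm_le_const (measure_lt_top _ _) fun t ht => ?_).trans
      (mul_le_of_le_one_right (by positivity) measureReal_le_one)
    rw [norm_mul, norm_mFourier_apply, one_mul]
    exact norm_geom_sum_le (hχ1 t) hc (hfar t ht) n
  have herr := NormedField.tendsto_zero_smul_of_tendsto_zero_of_bounded
    tendsto_log_natCast_atTop.inv_tendsto_atTop (isBoundedUnder_of ⟨2 / c, hcompl⟩)
  have hlim := (tendsto_inv_log_smul_sum_setIntegral_pow hS hχ hloc hδ0 hδ
    (fun x hx => (hnear x hx).2) l).add herr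
  rw [add_zero] at hlim
  refine hlim.congr fun n => ?_
  rw [hsplit, smul_add]
  rfl

theorem setIntegral_closedBall_norm_sum_pow_sq_le {δ : ℝ} (hS : S.PosDef) (hχ : Continuous χ)
    (hδ : δ < 1 / 2) (hnear : ∀ x ∈ closedBall 0 δ,
      x ⬝ᵥ S *ᵥ x ≤ 1 ∧ ‖χ (toTorus x)‖ ≤ Real.exp (-(x ⬝ᵥ S *ᵥ x))) (n : ℕ) :
    ∫ t in closedBall 0 δ, ‖∑ m ∈ range n, χ t ^ m‖ ^ 2 ∂torusHaar ≤
      Real.exp 1 * (Real.pi / √S.det) * (3 * n) := by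
  have hterm : ∀ k, Integrable (fun t => ‖χ t‖ ^ k) (torusHaar.restrict (closedBall 0 δ)) :=
    fun k => (integrable_of_continuous (by fun_prop)).integrableOn
  calc ∫ t in closedBall 0 δ, ‖∑ m ∈ range n, χ t ^ m‖ ^ 2 ∂torusHaar
      ≤ ∫ t in closedBall 0 δ, ∑ i ∈ range n, ∑ j ∈ range n, ‖χ t‖ ^ (i + j) ∂torusHaar :=
        integral_mono (integrable_of_continuous (by fun_prop)).integrableOn
          (integrable_finsetSum _ fun i _ => integrable_finsetSum _ fun j _ => hterm _)
          fun t => norm_geom_sum_sq_le _ _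
    _ = ∑ i ∈ range n, ∑ j ∈ range n, ∫ t in closedBall 0 δ, ‖χ t‖ ^ (i + j) ∂torusHaar := by
        rw [integral_finsetSum _ fun i _ => integrable_finsetSum _ fun j _ => hterm _]
        exact sum_congr rfl fun i _ => integral_finsetSum _ fun j _ => hterm _
    _ ≤ ∑ i ∈ range n, ∑ j ∈ range n,
          Real.exp 1 * (Real.pi / √S.det) * ((i + j : ℕ) + 1 : ℝ)⁻¹ := by
        gcongr with i _ j _
        rw [setIntegral_closedBall_torusHaar _ hδ]
        exact setIntegral_norm_pow_le hS (hχ.comp continuous_toTorus) hnear _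
    _ ≤ Real.exp 1 * (Real.pi / √S.det) * (3 * n) := by
        simp only [← mul_sum]
        gcongr
        exact sum_sum_inv_add_add_one_le n

theorem exists_integral_norm_sum_pow_sq_le (hS : S.PosDef) (hχ : Continuous χ)
    (hχ1 : ∀ t, ‖χ t‖ ≤ 1)
    (hloc : (fun x => χ (toTorus x) - (1 - 2 * Real.pi ^ 2 * (x ⬝ᵥ S *ᵥ x : ℝ))) =o[𝓝 0]
      fun x => x ⬝ᵥ S *ᵥ x)
    (hfar : ∀ U ∈ 𝓝 0, ∃ c > 0, ∀ t ∉ U, c ≤ ‖1 - χ t‖) :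
    ∃ K : ℝ, ∀ n : ℕ, ∫ t, ‖∑ m ∈ range n, χ t ^ m‖ ^ 2 ∂torusHaar ≤ K * n := by
  obtain ⟨δ, hδ0, hδ, hnear⟩ := exists_norm_le_exp_neg_on_closedBall hS hloc
  obtain ⟨c, hc, hfar⟩ := hfar _ (closedBall_mem_nhds 0 hδ0)
  refine ⟨Real.exp 1 * (Real.pi / √S.det) * 3 + 2 / c, fun n => ?_⟩
  have hbound : ∀ t ∈ (closedBall 0 δ)ᶜ, ‖‖∑ m ∈ range n, χ t ^ m‖ ^ 2‖ ≤ 2 / c * n := by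
    intro t ht
    have hn : ‖∑ m ∈ range n, χ t ^ m‖ ≤ n :=
      (norm_sum_le _ _).trans <| (sum_le_card_nsmul _ _ 1 fun m _ => by
        rw [norm_pow]
        exact pow_le_one₀ (norm_nonneg _) (hχ1 t)).trans_eq (by simp)
    rw [norm_pow, norm_norm, sq]
    exact mul_le_mul (norm_geom_sum_le (hχ1 t) hc (hfar t ht) n) hn (norm_nonneg _) (by positivity)
  have hcompl : ∫ t in (closedBall 0 δ)ᶜ, ‖∑ m ∈ range n, χ t ^ m‖ ^ 2 ∂torusHaar ≤
      2 / c * n :=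
    (Real.le_norm_self _).trans ((norm_setIntegral_le_of_norm_le_const (measure_lt_top _ _)
      hbound).trans (mul_le_of_le_one_right (by positivity) measureReal_le_one))
  rw [← integral_add_compl measurableSet_closedBall (integrable_of_continuous (by fun_prop)),
    add_mul, mul_assoc _ (3 : ℝ)]
  exact add_le_add (setIntegral_closedBall_norm_sum_pow_sq_le hS hχ hδ hnear n) hcompl

end TorusPowers

section Walk

theorem walk_sub_walk {Ω : Type*} {ζ : ℕ → Ω → (Fin 2 → ℤ)} {i j : ℕ} (hij : i ≤ j) (ω : Ω) :
    walk ζ j ω - walk ζ i ω = ∑ k ∈ Ico i j, ζ k ω :=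
  (sum_Ico_eq_sub _ hij).symm

variable {Ω : Type*} [MeasurableSpace Ω] {P : Measure Ω} {ζ : ℕ → Ω → (Fin 2 → ℤ)}

/-- The steps `ζ 0, ζ 1, …` of a walk in `ℤ²` are independent and identically distributed. -/
structure HasIIDSteps (P : Measure Ω) (ζ : ℕ → Ω → (Fin 2 → ℤ)) : Prop where
  measurable : ∀ i, Measurable (ζ i)
  indep : iIndepFun ζ P
  ident : ∀ i, IdentDistrib (ζ i) (ζ 0) P P

/-- A genuinely two-dimensional, centred, aperiodic random walk with square integrable steps. -/
structure IsPlanarWalk (P : Measure Ω) (ζ : ℕ → Ω → (Fin 2 → ℤ)) : Prop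
    extends HasIIDSteps P ζ where
  isAperiodic : IsAperiodic P (ζ 0)
  memLp : ∀ c, MemLp (fun ω => (ζ 0 ω c : ℝ)) 2 P
  mean : ∀ c, ∫ ω, (ζ 0 ω c : ℝ) ∂P = 0
  det_ne_zero : (covMatrix P (ζ 0)).det ≠ 0

/-- The probability that the walk is at `l` at time `m`. -/
noncomputable def hitProb (P : Measure Ω) (ζ : ℕ → Ω → (Fin 2 → ℤ)) (m : ℕ) (l : Fin 2 → ℤ) :
    ℝ≥0∞ :=
  P {ω | walk ζ m ω = l}

/-- The truncated Green function: the expected number of visits to `l` before time `n`. -/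
noncomputable def green (P : Measure Ω) (ζ : ℕ → Ω → (Fin 2 → ℤ)) (n : ℕ) (l : Fin 2 → ℤ) :
    ℝ≥0∞ :=
  ∑ m ∈ range n, hitProb P ζ m l

theorem hitProb_zero [IsProbabilityMeasure P] (l : Fin 2 → ℤ) :
    hitProb P ζ 0 l = if l = 0 then 1 else 0 := by
  split_ifs with h
  · simp [hitProb, walk, h]
  · simp [hitProb, walk, Ne.symm h]

theorem toReal_green [IsFiniteMeasure P] (n : ℕ) (l : Fin 2 → ℤ) :
    (green P ζ n l).toReal = ∑ m ∈ range n, (hitProb P ζ m l).toReal :=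
  ENNReal.toReal_sum fun _ _ => measure_ne_top P _

namespace HasIIDSteps

theorem isProbabilityMeasure (h : HasIIDSteps P ζ) : IsProbabilityMeasure P :=
  h.indep.isProbabilityMeasure

theorem measurable_walk (h : HasIIDSteps P ζ) (n : ℕ) : Measurable (walk ζ n) :=
  Finset.measurable_fun_sum _ fun i _ => h.measurable i

theorem continuous_latticeCharFun (h : HasIIDSteps P ζ) : Continuous (latticeCharFun P (ζ 0)) :=
  have := h.isProbabilityMeasure
  QuenchedRW.continuous_latticeCharFun (h.measurable 0)

theorem mFourierCoeff_latticeCharFun_pow (h : HasIIDSteps P ζ) (s : Finset ℕ) (l : Fin 2 → ℤ) :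
    mFourierCoeff (fun t => latticeCharFun P (ζ 0) t ^ #s) l =
      P.real {ω | ∑ i ∈ s, ζ i ω = l} := by
  have := h.isProbabilityMeasure
  simp_rw [← latticeCharFun_sum_of_identDistrib h.measurable h.indep h.ident s]
  exact mFourierCoeff_latticeCharFun (Finset.measurable_fun_sum s fun i _ => h.measurable i) l

theorem measure_sum_eq (h : HasIIDSteps P ζ) (s : Finset ℕ) (l : Fin 2 → ℤ) :
    P {ω | ∑ i ∈ s, ζ i ω = l} = hitProb P ζ #s l := by
  have := h.isProbabilityMeasure
  have hreal := (h.mFourierCoeff_latticeCharFun_pow s l).symm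
  rw [← card_range #s, h.mFourierCoeff_latticeCharFun_pow] at hreal
  rw [hitProb, ← measureReal_eq_measureReal_iff]
  exact_mod_cast hreal

theorem mFourierCoeff_sum_latticeCharFun_pow (h : HasIIDSteps P ζ) (n : ℕ) (l : Fin 2 → ℤ) :
    mFourierCoeff (fun t => ∑ m ∈ range n, latticeCharFun P (ζ 0) t ^ m) l =
      ((green P ζ n l).toReal : ℂ) := by
  have := h.isProbabilityMeasure
  have hcont : ∀ m ∈ range n, Continuous fun t => latticeCharFun P (ζ 0) t ^ m :=
    fun m _ => h.continuous_latticeCharFun.pow m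
  rw [mFourierCoeff_sum _ hcont, toReal_green, Complex.ofReal_sum]
  refine sum_congr rfl fun m _ => ?_
  nth_rw 1 [← card_range m]
  exact h.mFourierCoeff_latticeCharFun_pow _ l

theorem measure_sum_eq_and_sum_eq (h : HasIIDSteps P ζ) {s t : Finset ℕ} (hst : Disjoint s t)
    (x y : Fin 2 → ℤ) :
    P {ω | ∑ i ∈ s, ζ i ω = x ∧ ∑ i ∈ t, ζ i ω = y} = hitProb P ζ #s x * hitProb P ζ #t y := by
  have hindep := (h.indep.indepFun_finset s t hst h.measurable).comp
    (φ := fun v => ∑ i, v i) (ψ := fun v => ∑ i, v i) (by fun_prop) (by fun_prop)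
  have hsum : ∀ u : Finset ℕ, (fun ω => ∑ i : u, ζ i ω) = fun ω => ∑ i ∈ u, ζ i ω :=
    fun u => funext fun ω => sum_coe_sort u (ζ · ω)
  simp only [Function.comp_def, hsum] at hindep
  rw [← h.measure_sum_eq, ← h.measure_sum_eq]
  exact hindep.measure_inter_preimage_eq_mul _ _ (measurableSet_singleton x)
    (measurableSet_singleton y)

theorem measure_walk_sub_walk_eq (h : HasIIDSteps P ζ) {i j : ℕ} (hij : i ≤ j) (l : Fin 2 → ℤ) :
    P {ω | walk ζ j ω - walk ζ i ω = l} = hitProb P ζ (j - i) l := by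
  simp_rw [walk_sub_walk hij]
  rw [h.measure_sum_eq, Nat.card_Ico]

end HasIIDSteps

namespace IsPlanarWalk

open Matrix

theorem tendsto_inv_log_mul_green (h : IsPlanarWalk P ζ) (l : Fin 2 → ℤ) :
    Tendsto (fun n : ℕ => (Real.log n)⁻¹ * (green P ζ n l).toReal) atTop
      (𝓝 (2 * Real.pi * √(covMatrix P (ζ 0)).det)⁻¹) := by
  have := h.isProbabilityMeasure
  have hlim := tendsto_inv_log_smul_mFourierCoeff_sum_pow
    (posDef_covMatrix h.memLp h.det_ne_zero) h.continuous_latticeCharFun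
    norm_latticeCharFun_le_one
    (isLittleO_latticeCharFun_toTorus_sub_covMatrix (h.measurable 0) h.memLp h.mean h.det_ne_zero)
    (fun U => exists_le_norm_one_sub_latticeCharFun (h.measurable 0) h.isAperiodic) l
  simp only [h.mFourierCoeff_sum_latticeCharFun_pow, Complex.real_smul] at hlim
  exact tendsto_ofReal_iff.1 (by exact_mod_cast hlim)

theorem exists_tsum_green_sq_le (h : IsPlanarWalk P ζ) :
    ∃ K : ℝ≥0, ∀ n : ℕ, ∑' x, green P ζ n x ^ 2 ≤ K * n := by
  have := h.isProbabilityMeasure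
  obtain ⟨K, hK⟩ := exists_integral_norm_sum_pow_sq_le
    (posDef_covMatrix h.memLp h.det_ne_zero) h.continuous_latticeCharFun
    norm_latticeCharFun_le_one
    (isLittleO_latticeCharFun_toTorus_sub_covMatrix (h.measurable 0) h.memLp h.mean h.det_ne_zero)
    (fun U => exists_le_norm_one_sub_latticeCharFun (h.measurable 0) h.isAperiodic)
  refine ⟨K.toNNReal, fun n => ?_⟩
  have hfin : ∀ x, green P ζ n x ≠ ∞ := fun x => ENNReal.sum_ne_top.2 fun _ _ => measure_ne_top P _
  have hcont : Continuous fun t => ∑ m ∈ range n, latticeCharFun P (ζ 0) t ^ m :=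
    continuous_finsetSum _ fun m _ => h.continuous_latticeCharFun.pow m
  have hparseval := hasSum_sq_norm_mFourierCoeff hcont
  simp only [h.mFourierCoeff_sum_latticeCharFun_pow, Complex.norm_real, Real.norm_eq_abs,
    sq_abs] at hparseval
  calc ∑' x, green P ζ n x ^ 2
      = ∑' x, ENNReal.ofReal ((green P ζ n x).toReal ^ 2) := by
        simp_rw [ENNReal.ofReal_pow ENNReal.toReal_nonneg, ENNReal.ofReal_toReal (hfin _)]
    _ = ENNReal.ofReal (∫ t, ‖∑ m ∈ range n, latticeCharFun P (ζ 0) t ^ m‖ ^ 2 ∂torusHaar) := by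
        rw [← ENNReal.ofReal_tsum_of_nonneg (fun x => by positivity) hparseval.summable,
          hparseval.tsum_eq]
    _ ≤ ENNReal.ofReal (K * n) := ENNReal.ofReal_le_ofReal (hK n)
    _ = K.toNNReal * n := by rw [ENNReal.ofReal_mul' n.cast_nonneg, ENNReal.ofReal_natCast]; rfl

end IsPlanarWalk

end Walk

section PairCount

variable {G : Type*} [AddCommGroup G] [DecidableEq G]

/-- The number of pairs of times `(i, j) ∈ A × B` between which the sequence `z` makes the
displacement `l`, i.e. `z i - z j = l`. It is real-valued because it gets averaged. -/
def pairCount (z : ℕ → G) (A B : Finset ℕ) (l : G) : ℝ :=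
  ∑ i ∈ A, ∑ j ∈ B, if z i - z j = l then 1 else 0

theorem pairCount_nonneg (z : ℕ → G) (A B : Finset ℕ) (l : G) : 0 ≤ pairCount z A B l :=
  sum_nonneg fun _ _ => sum_nonneg fun _ _ => by positivity

theorem pairCount_le_card (z : ℕ → G) (A B : Finset ℕ) (l : G) :
    pairCount z A B l ≤ #A * #B := by
  calc pairCount z A B l ≤ ∑ _i ∈ A, ∑ _j ∈ B, (1 : ℝ) :=
        sum_le_sum fun _ _ => sum_le_sum fun _ _ => by split_ifs <;> norm_num
    _ = #A * #B := by simp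

theorem pairCount_mono (z : ℕ → G) {A A' B B' : Finset ℕ} (hA : A ⊆ A') (hB : B ⊆ B') (l : G) :
    pairCount z A B l ≤ pairCount z A' B' l :=
  (sum_le_sum fun _ _ => sum_le_sum_of_subset_of_nonneg hB fun _ _ _ => by positivity).trans
    (sum_le_sum_of_subset_of_nonneg hA fun _ _ _ => sum_nonneg fun _ _ => by positivity)

theorem pairCount_swap (z : ℕ → G) (A B : Finset ℕ) (l : G) :
    pairCount z B A l = pairCount z A B (-l) := by
  have hneg : ∀ i j, z j - z i = l ↔ z i - z j = -l := fun i j => by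
    rw [← neg_sub, neg_eq_iff_eq_neg]
  rw [pairCount, sum_comm]
  simp_rw [hneg, pairCount]

theorem pairCount_union_left (z : ℕ → G) {A A' : Finset ℕ} (h : Disjoint A A') (B : Finset ℕ)
    (l : G) : pairCount z (A ∪ A') B l = pairCount z A B l + pairCount z A' B l :=
  sum_union h

theorem pairCount_union_right (z : ℕ → G) (A : Finset ℕ) {B B' : Finset ℕ} (h : Disjoint B B')
    (l : G) : pairCount z A (B ∪ B') l = pairCount z A B l + pairCount z A B' l := by
  simp_rw [pairCount, sum_union h, sum_add_distrib]

theorem pairCount_singleton_self (z : ℕ → G) (i : ℕ) (l : G) :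
    pairCount z {i} {i} l = if l = 0 then 1 else 0 := by
  simp [pairCount, -sum_boole, eq_comm]

theorem pairCount_Ico_split (z : ℕ → G) {u v w : ℕ} (huv : u ≤ v) (hvw : v ≤ w) (l : G) :
    pairCount z (Ico u w) (Ico u w) l =
      pairCount z (Ico u v) (Ico u v) l + pairCount z (Ico v w) (Ico v w) l +
        (pairCount z (Ico u v) (Ico v w) l + pairCount z (Ico u v) (Ico v w) (-l)) := by
  have hdisj := Ico_disjoint_Ico_consecutive u v w
  rw [← Ico_union_Ico_eq_Ico huv hvw, pairCount_union_left z hdisj, pairCount_union_right z _ hdisj,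
    pairCount_union_right z _ hdisj, pairCount_swap z (Ico u v) (Ico v w) l]
  ring

end PairCount

section PairCountOfWalk

variable {Ω : Type*} [MeasurableSpace Ω] {P : Measure Ω} {ζ : ℕ → Ω → (Fin 2 → ℤ)}

namespace HasIIDSteps

theorem measurableSet_walk_sub_walk_eq (h : HasIIDSteps P ζ) (i j : ℕ) (l : Fin 2 → ℤ) :
    MeasurableSet {ω | walk ζ i ω - walk ζ j ω = l} :=
  ((h.measurable_walk i).sub (h.measurable_walk j)) (measurableSet_singleton l)

theorem measurable_pairCount (h : HasIIDSteps P ζ) (A B : Finset ℕ) (l : Fin 2 → ℤ) :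
    Measurable fun ω => pairCount (walk ζ · ω) A B l :=
  Finset.measurable_fun_sum _ fun i _ => Finset.measurable_fun_sum _ fun j _ =>
    .ite (h.measurableSet_walk_sub_walk_eq i j l) measurable_const measurable_const

theorem memLp_pairCount (h : HasIIDSteps P ζ) (A B : Finset ℕ) (l : Fin 2 → ℤ) (p : ℝ≥0∞) :
    MemLp (fun ω => pairCount (walk ζ · ω) A B l) p P := by
  have := h.isProbabilityMeasure
  refine .of_bound (h.measurable_pairCount A B l).aestronglyMeasurable (#A * #B)
    (ae_of_all _ fun ω => ?_)
  rw [Real.norm_of_nonneg (pairCount_nonneg _ _ _ _)]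
  exact pairCount_le_card _ _ _ _

theorem integrable_pairCount (h : HasIIDSteps P ζ) (A B : Finset ℕ) (l : Fin 2 → ℤ) :
    Integrable (fun ω => pairCount (walk ζ · ω) A B l) P :=
  memLp_one_iff_integrable.1 (h.memLp_pairCount A B l 1)

theorem integral_pairCount_Ico_singleton (h : HasIIDSteps P ζ) (u n : ℕ) (l : Fin 2 → ℤ) :
    ∫ ω, pairCount (walk ζ · ω) (Ico u (u + n)) {u + n} l ∂P =
      (green P ζ (n + 1) (-l)).toReal - if l = 0 then 1 else 0 := by
  have := h.isProbabilityMeasure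
  have hprob : ∀ i ∈ Ico u (u + n), P.real {ω | walk ζ i ω - walk ζ (u + n) ω = l} =
      (hitProb P ζ (u + n - i) (-l)).toReal := fun i hi => by
    simp_rw [measureReal_def, ← h.measure_walk_sub_walk_eq (mem_Ico.1 hi).2.le, ← neg_eq_iff_eq_neg,
      neg_sub]
  have hind : ∀ i ω, (if walk ζ i ω - walk ζ (u + n) ω = l then (1 : ℝ) else 0) =
      {ω | walk ζ i ω - walk ζ (u + n) ω = l}.indicator 1 ω := fun i ω => by
    simp [Set.indicator_apply]
  have hms := (h.measurableSet_walk_sub_walk_eq · (u + n) l)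
  have hzero : (hitProb P ζ 0 (-l)).toReal = if l = 0 then 1 else 0 := by
    rw [hitProb_zero]
    split_ifs <;> simp_all
  simp_rw [pairCount, sum_singleton, hind]
  rw [integral_finsetSum _ fun i _ => (integrable_const 1).indicator (hms i), toReal_green,
    sum_range_succ', hzero, add_sub_cancel_right, ← sum_range_reflect, sum_Ico_eq_sum_range]
  simp_rw [integral_indicator_one (hms _)]
  refine sum_congr (by simp) fun k hk => ?_
  rw [mem_range] at hk
  rw [hprob _ (by simp; omega)]
  congr 2
  omega

theorem integral_pairCount_Ico (h : HasIIDSteps P ζ) (u n : ℕ) (l : Fin 2 → ℤ) :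
    ∫ ω, pairCount (walk ζ · ω) (Ico u (u + n)) (Ico u (u + n)) l ∂P =
      ∑ m ∈ range n, ((green P ζ (m + 1) l).toReal + (green P ζ (m + 1) (-l)).toReal -
        if l = 0 then 1 else 0) := by
  have := h.isProbabilityMeasure
  induction n with
  | zero => simp [pairCount]
  | succ n ih =>
    have hint := fun A B l => h.integrable_pairCount A B l
    simp_rw [← add_assoc u n 1, pairCount_Ico_split _ (Nat.le_add_right u n) (Nat.le_succ (u + n)),
      Nat.Ico_succ_singleton, pairCount_singleton_self]
    rw [integral_add ((hint _ _ _).fun_add (integrable_const _))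
        ((hint _ _ _).fun_add (hint _ _ _)),
      integral_add (hint _ _ _) (integrable_const _), integral_add (hint _ _ _) (hint _ _ _), ih,
      h.integral_pairCount_Ico_singleton, h.integral_pairCount_Ico_singleton, sum_range_succ]
    simp only [integral_const, probReal_univ, smul_eq_mul, one_mul, neg_neg, neg_eq_zero]
    ring

end HasIIDSteps

namespace IsPlanarWalk

theorem isLittleO_green_succ_sub_log (h : IsPlanarWalk P ζ) (l : Fin 2 → ℤ) :
    (fun n : ℕ => (green P ζ (n + 1) l).toReal -
      Real.log n * (2 * Real.pi * √(covMatrix P (ζ 0)).det)⁻¹) =o[atTop]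
      fun n : ℕ => Real.log n := by
  have := h.isProbabilityMeasure
  have hlast : (fun n => (hitProb P ζ n l).toReal) =O[atTop] fun _ : ℕ => (1 : ℝ) :=
    .of_bound 1 (.of_forall fun n => by
      rw [Real.norm_of_nonneg ENNReal.toReal_nonneg, norm_one, mul_one]
      exact measureReal_le_one)
  have hlog : ∀ᶠ n : ℕ in atTop, Real.log n ≠ 0 :=
    (tendsto_log_natCast_atTop.eventually_gt_atTop 0).mono fun _ => ne_of_gt
  have hgreen : (fun n : ℕ => (green P ζ n l).toReal -
      Real.log n * (2 * Real.pi * √(covMatrix P (ζ 0)).det)⁻¹) =o[atTop]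
      fun n : ℕ => Real.log n := by
    rw [Asymptotics.isLittleO_iff_tendsto' (hlog.mono fun n hn h0 => absurd h0 hn)]
    refine ((h.tendsto_inv_log_mul_green l).sub_const _).congr' (hlog.mono fun n hn => ?_) |>.trans
      (by rw [sub_self])
    field_simp
  refine ((hlast.trans_isLittleO (Real.isLittleO_const_log_atTop.comp_tendsto
    tendsto_natCast_atTop_atTop)).add hgreen).congr_left fun n => ?_
  rw [toReal_green, toReal_green, sum_range_succ]
  ring

theorem tendsto_integral_pairCount_Ico (h : IsPlanarWalk P ζ) (u : ℕ)
    (l : Fin 2 → ℤ) :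
    Tendsto (fun n : ℕ => (n * Real.log n)⁻¹ *
        ∫ ω, pairCount (walk ζ · ω) (Ico u (u + n)) (Ico u (u + n)) l ∂P)
      atTop (𝓝 (selfIntersectionConst (covMatrix P (ζ 0)))) := by
  have hgreen := h.isLittleO_green_succ_sub_log
  refine (tendsto_inv_smul_sum_range (fun n => Real.log_natCast_nonneg n)
    (tendsto_natCast_atTop_atTop.atTop_mul_atTop₀ tendsto_log_natCast_atTop)
    tendsto_inv_mul_log_mul_sum_log ?_).congr fun n => by rw [h.integral_pairCount_Ico, smul_eq_mul]
  refine (((hgreen l).add (hgreen (-l))).sub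
    ((Real.isLittleO_const_log_atTop (c := if l = 0 then 1 else 0)).comp_tendsto
      tendsto_natCast_atTop_atTop)).congr_left fun n => ?_
  simp only [selfIntersectionConst, Function.comp_apply, smul_eq_mul, mul_inv]
  ring

end IsPlanarWalk

end PairCountOfWalk

section DoubleSums

theorem ennreal_mul_le_sq_add_sq (a b : ℝ≥0∞) : a * b ≤ a ^ 2 + b ^ 2 := by
  wlog hab : a ≤ b generalizing a b
  · rw [mul_comm, add_comm]
    exact this b a (le_of_not_ge hab)
  calc a * b ≤ b * b := by gcongr
    _ = b ^ 2 := (sq b).symm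
    _ ≤ a ^ 2 + b ^ 2 := le_add_self

theorem ennreal_add_sq_le (a b : ℝ≥0∞) : (a + b) ^ 2 ≤ 3 * (a ^ 2 + b ^ 2) := by
  calc (a + b) ^ 2 = a ^ 2 + b ^ 2 + 2 * (a * b) := by ring
    _ ≤ a ^ 2 + b ^ 2 + 2 * (a ^ 2 + b ^ 2) := by
      gcongr
      exact ennreal_mul_le_sq_add_sq a b
    _ = 3 * (a ^ 2 + b ^ 2) := by ring

variable {G : Type*} [AddCommGroup G]

theorem tsum_tsum_sq_mul_sub (a b : G → ℝ≥0∞) :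
    ∑' x, ∑' y, (a x * b (y - x)) ^ 2 = (∑' x, a x ^ 2) * ∑' x, b x ^ 2 := by
  have htranslate : ∀ x, ∑' y, b (y - x) ^ 2 = ∑' y, b y ^ 2 := fun x =>
    (Equiv.subRight x).tsum_eq fun y => b y ^ 2
  simp_rw [mul_pow, ENNReal.tsum_mul_left, htranslate, ENNReal.tsum_mul_right]

theorem tsum_tsum_sq_le_of_le_mul_sub {F : G → G → ℝ≥0∞} {a b : G → ℝ≥0∞}
    (hF : ∀ x y, F x y ≤ a x * b (y - x) + a y * b (x - y)) :
    ∑' x, ∑' y, F x y ^ 2 ≤ 6 * ((∑' x, a x ^ 2) * ∑' x, b x ^ 2) := by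
  calc ∑' x, ∑' y, F x y ^ 2
      ≤ ∑' x, ∑' y, 3 * ((a x * b (y - x)) ^ 2 + (a y * b (x - y)) ^ 2) :=
        ENNReal.tsum_le_tsum fun x => ENNReal.tsum_le_tsum fun y =>
          (pow_le_pow_left₀ zero_le (hF x y) 2).trans (ennreal_add_sq_le _ _)
    _ = 3 * (∑' x, ∑' y, (a x * b (y - x)) ^ 2 + ∑' y, ∑' x, (a y * b (x - y)) ^ 2) := by
        simp_rw [ENNReal.tsum_mul_left, ENNReal.tsum_add]
        rw [ENNReal.tsum_comm (f := fun x y => (a y * b (x - y)) ^ 2)]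
    _ = 6 * ((∑' x, a x ^ 2) * ∑' x, b x ^ 2) := by
        rw [tsum_tsum_sq_mul_sub]
        ring

end DoubleSums

section LocalTime

/-- The number of times in `A` at which the sequence `z` visits `x`. -/
noncomputable def localTime {G : Type*} [DecidableEq G] (z : ℕ → G) (A : Finset ℕ) (x : G) :
    ℝ≥0∞ :=
  ∑ i ∈ A, if z i = x then 1 else 0

theorem ofReal_pairCount {G : Type*} [AddCommGroup G] [DecidableEq G] (z : ℕ → G)
    (A B : Finset ℕ) (l c : G) :
    ENNReal.ofReal (pairCount z A B l) =
      ∑' x, localTime (z · - c) A x * localTime (z · - c) B (x - l) := by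
  have hmatch : ∀ i j, ∑' x, ((if z i - c = x then 1 else 0) * if z j - c = x - l then 1 else 0) =
      ENNReal.ofReal (if z i - z j = l then 1 else 0) := fun i j => by
    rw [tsum_eq_single (z i - c) fun x hx => by rw [if_neg hx.symm, zero_mul], if_pos rfl, one_mul]
    have hiff : z j - c = z i - c - l ↔ z i - z j = l := by
      rw [sub_right_comm, sub_left_inj, eq_sub_iff_add_eq, sub_eq_iff_eq_add', eq_comm]
    simp_rw [hiff]
    split_ifs <;> simp
  simp_rw [localTime, sum_mul_sum]
  rw [Summable.tsum_finsetSum fun _ _ => ENNReal.summable, pairCount,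
    ENNReal.ofReal_sum_of_nonneg fun _ _ => sum_nonneg fun _ _ => by positivity]
  refine sum_congr rfl fun i _ => ?_
  rw [Summable.tsum_finsetSum fun _ _ => ENNReal.summable,
    ENNReal.ofReal_sum_of_nonneg fun _ _ => by positivity]
  exact sum_congr rfl fun j _ => (hmatch i j).symm

variable {Ω : Type*} [MeasurableSpace Ω] {P : Measure Ω} {ζ : ℕ → Ω → (Fin 2 → ℤ)}

namespace HasIIDSteps

theorem comp_injective (h : HasIIDSteps P ζ) {σ : ℕ → ℕ} (hσ : σ.Injective) :
    HasIIDSteps P fun k => ζ (σ k) where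
  measurable k := h.measurable (σ k)
  indep := h.indep.precomp hσ
  ident k := (h.ident (σ k)).trans (h.ident (σ 0)).symm

theorem hitProb_comp_injective (h : HasIIDSteps P ζ) {σ : ℕ → ℕ} (hσ : σ.Injective) (m : ℕ)
    (l : Fin 2 → ℤ) : hitProb P (fun k => ζ (σ k)) m l = hitProb P ζ m l := by
  have hwalk : ∀ ω, walk (fun k => ζ (σ k)) m ω = ∑ i ∈ (range m).image σ, ζ i ω := fun ω =>
    (sum_image (f := (ζ · ω)) fun _ _ _ _ hij => hσ hij).symm
  simp_rw [hitProb, hwalk]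
  rw [h.measure_sum_eq, card_image_of_injective _ hσ, card_range, hitProb]

theorem green_comp_injective (h : HasIIDSteps P ζ) {σ : ℕ → ℕ} (hσ : σ.Injective) (n : ℕ) :
    green P (fun k => ζ (σ k)) n = green P ζ n :=
  funext fun l => sum_congr rfl fun m _ => h.hitProb_comp_injective hσ m l

theorem measure_walk_eq_and_walk_eq (h : HasIIDSteps P ζ) {k m : ℕ} (hkm : k ≤ m)
    (x y : Fin 2 → ℤ) :
    P {ω | walk ζ k ω = x ∧ walk ζ m ω = y} = hitProb P ζ k x * hitProb P ζ (m - k) (y - x) := by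
  have hdisj : Disjoint (range k) (Ico k m) := by
    rw [range_eq_Ico]
    exact Ico_disjoint_Ico_consecutive 0 k m
  have hprod := h.measure_sum_eq_and_sum_eq hdisj x (y - x)
  rw [card_range, Nat.card_Ico] at hprod
  rw [← hprod]
  congr 1 with ω
  refine and_congr_right fun hx : walk ζ k ω = x => ?_
  rw [← walk_sub_walk hkm, hx, sub_left_inj]

theorem sum_measure_walk_eq_and_walk_eq_le (h : HasIIDSteps P ζ) (n : ℕ) (x y : Fin 2 → ℤ) :
    ∑ k ∈ range n, ∑ m ∈ Ico k n, P {ω | walk ζ k ω = x ∧ walk ζ m ω = y} ≤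
      green P ζ n x * green P ζ n (y - x) := by
  rw [green, sum_mul]
  refine sum_le_sum fun k _ => ?_
  rw [sum_congr rfl fun m hm => h.measure_walk_eq_and_walk_eq (mem_Ico.1 hm).1 x y, ← mul_sum,
    sum_Ico_eq_sum_range]
  simp only [Nat.add_sub_cancel_left]
  gcongr
  exact sum_le_sum_of_subset (range_subset_range.2 (Nat.sub_le n k))

theorem lintegral_localTime_mul_localTime_le (h : HasIIDSteps P ζ) (n : ℕ) (x y : Fin 2 → ℤ) :
    ∫⁻ ω, localTime (walk ζ · ω) (range n) x * localTime (walk ζ · ω) (range n) y ∂P ≤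
      green P ζ n x * green P ζ n (y - x) + green P ζ n y * green P ζ n (x - y) := by
  have hms : ∀ k m, MeasurableSet {ω | walk ζ k ω = x ∧ walk ζ m ω = y} := fun k m =>
    (h.measurable_walk k (measurableSet_singleton x)).inter
      (h.measurable_walk m (measurableSet_singleton y))
  have hind : ∀ k m ω, ((if walk ζ k ω = x then 1 else 0) * if walk ζ m ω = y then 1 else 0) =
      {ω | walk ζ k ω = x ∧ walk ζ m ω = y}.indicator (1 : Ω → ℝ≥0∞) ω := fun k m ω => by
    simp [Set.indicator_apply, ← ite_and, and_comm]
  have hmeas : ∀ k m, Measurable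
      ({ω | walk ζ k ω = x ∧ walk ζ m ω = y}.indicator (1 : Ω → ℝ≥0∞)) := fun k m =>
    measurable_const.indicator (hms k m)
  simp_rw [localTime, sum_mul_sum, hind]
  rw [lintegral_finsetSum _ fun k _ => Finset.measurable_fun_sum _ fun m _ => hmeas k m]
  simp_rw [lintegral_finsetSum _ fun m _ => hmeas _ m, lintegral_indicator_one (hms _ _)]
  calc ∑ k ∈ range n, ∑ m ∈ range n, P {ω | walk ζ k ω = x ∧ walk ζ m ω = y}
      ≤ ∑ k ∈ range n, (∑ m ∈ Ico k n, P {ω | walk ζ k ω = x ∧ walk ζ m ω = y} +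
          ∑ m ∈ range (k + 1), P {ω | walk ζ k ω = x ∧ walk ζ m ω = y}) := by
        refine sum_le_sum fun k hk => ?_
        rw [← sum_range_add_sum_Ico _ (mem_range.1 hk).le, add_comm]
        gcongr
        exact k.le_succ
    _ = ∑ k ∈ range n, ∑ m ∈ Ico k n, P {ω | walk ζ k ω = x ∧ walk ζ m ω = y} +
          ∑ m ∈ range n, ∑ k ∈ Ico m n, P {ω | walk ζ m ω = y ∧ walk ζ k ω = x} := by
        rw [sum_add_distrib]
        congr 1
        simp_rw [and_comm (a := walk ζ _ _ = y)]
        exact sum_comm' fun k m => by simp only [mem_range, mem_Ico]; omega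
    _ ≤ _ := add_le_add (h.sum_measure_walk_eq_and_walk_eq_le n x y)
        (h.sum_measure_walk_eq_and_walk_eq_le n y x)

end HasIIDSteps

end LocalTime

section Blocks

theorem dependsOn_sum_range_sub_sum_range {G : Type*} [AddCommGroup G] {u v i j : ℕ}
    (hi : i ∈ Set.Icc u v) (hj : j ∈ Set.Icc u v) :
    DependsOn (fun s : ℕ → G => ∑ k ∈ range i, s k - ∑ k ∈ range j, s k) (Ico u v : Set ℕ) := by
  have hsum : ∀ {a b}, u ≤ a → b ≤ v →
      DependsOn (fun s : ℕ → G => (Ico a b).sum s) (Ico u v : Set ℕ) := fun ha hb s s' hs =>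
    sum_congr rfl fun _ hk => hs _ (Ico_subset_Ico ha hb hk)
  intro s s' hs
  rcases le_total j i with hji | hij
  · simp_rw [← sum_Ico_eq_sub _ hji]
    exact hsum hj.1 hi.2 hs
  · simp_rw [← neg_sub ((range j).sum _), ← sum_Ico_eq_sub _ hij]
    exact congrArg Neg.neg (hsum hi.1 hj.2 hs)

theorem dependsOn_pairCount_Ico {G : Type*} [AddCommGroup G] [DecidableEq G] (u v : ℕ) (l : G) :
    DependsOn (fun s : ℕ → G => pairCount (fun n => ∑ k ∈ range n, s k) (Ico u v) (Ico u v) l)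
      (Ico u v : Set ℕ) := fun s s' hs =>
  sum_congr rfl fun i hi => sum_congr rfl fun j hj => by
    simp only [dependsOn_sum_range_sub_sum_range (Set.mem_Icc_of_Ico (mem_Ico.1 hi))
      (Set.mem_Icc_of_Ico (mem_Ico.1 hj)) hs]

theorem dependsOn_localTime {G : Type*} [AddCommGroup G] [DecidableEq G] {u v c : ℕ}
    (hc : c ∈ Set.Icc u v) :
    DependsOn (fun s : ℕ → G =>
      localTime (fun n => ∑ k ∈ range n, s k - ∑ k ∈ range c, s k) (Ico u v))
      (Ico u v : Set ℕ) := fun s s' hs =>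
  funext fun x => sum_congr rfl fun i hi => by
    simp only [dependsOn_sum_range_sub_sum_range (Set.mem_Icc_of_Ico (mem_Ico.1 hi)) hc hs]

variable {Ω : Type*} [MeasurableSpace Ω] {P : Measure Ω} {ζ : ℕ → Ω → (Fin 2 → ℤ)}

theorem indepFun_of_dependsOn {X α β : Type*} [MeasurableSpace X] [Countable X]
    [MeasurableSingletonClass X] [Inhabited X] [MeasurableSpace α] [MeasurableSpace β]
    {ξ : ℕ → Ω → X} (hξ : iIndepFun ξ P) (hmeas : ∀ i, Measurable (ξ i))
    {F : (ℕ → X) → α} {G : (ℕ → X) → β} {S T : Finset ℕ}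
    (hF : DependsOn F (S : Set ℕ)) (hG : DependsOn G (T : Set ℕ)) (hST : Disjoint S T) :
    IndepFun (fun ω => F (ξ · ω)) (fun ω => G (ξ · ω)) P := by
  have hindep := (hξ.indepFun_finset S T hST hmeas).comp
    (φ := fun r => F fun i => if hi : i ∈ S then r ⟨i, hi⟩ else default)
    (ψ := fun r => G fun i => if hi : i ∈ T then r ⟨i, hi⟩ else default)
    (measurable_of_countable _) (measurable_of_countable _)
  convert! hindep using 1
  · exact funext fun ω => hF fun i hi => by simp [mem_coe.1 hi]
  · exact funext fun ω => hG fun i hi => by simp [mem_coe.1 hi]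

theorem localTime_walk_sub_walk_future {Ω : Type*} (ζ : ℕ → Ω → (Fin 2 → ℤ)) (v n : ℕ) (ω : Ω)
    (x : Fin 2 → ℤ) :
    localTime (fun i => walk ζ i ω - walk ζ v ω) (Ico v (v + n)) x =
      localTime (walk (fun k => ζ (v + k)) · ω) (range n) x := by
  simp_rw [localTime, sum_Ico_eq_sum_range, Nat.add_sub_cancel_left,
    walk_sub_walk (Nat.le_add_right v _), sum_Ico_eq_sum_range, Nat.add_sub_cancel_left]
  rfl

/-- The permutation of the steps that runs through the first `v` of them backwards; it exchanges
the past of the walk at time `v` with the start of another walk with the same law. -/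
def reverseSteps (v k : ℕ) : ℕ :=
  if k < v then v - 1 - k else k

theorem reverseSteps_injective (v : ℕ) : (reverseSteps v).Injective := fun i j hij => by
  simp only [reverseSteps] at hij
  split_ifs at hij <;> omega

theorem walk_reverseSteps {Ω : Type*} (ζ : ℕ → Ω → (Fin 2 → ℤ)) {v k : ℕ} (hk : k ≤ v) (ω : Ω) :
    walk (fun j => ζ (reverseSteps v j)) k ω = -(walk ζ (v - k) ω - walk ζ v ω) := by
  rw [neg_sub, walk_sub_walk (Nat.sub_le v k), walk,
    sum_Ico_eq_sum_range, Nat.sub_sub_self hk, ← sum_range_reflect]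
  refine sum_congr rfl fun j hj => ?_
  have hjk := mem_range.1 hj
  rw [reverseSteps, if_pos (by omega)]
  congr 1
  omega

theorem localTime_walk_sub_walk_past_le {Ω : Type*} (ζ : ℕ → Ω → (Fin 2 → ℤ)) {u v n : ℕ}
    (hn : v < u + n) (ω : Ω) (x : Fin 2 → ℤ) :
    localTime (fun i => walk ζ i ω - walk ζ v ω) (Ico u v) x ≤
      localTime (walk (fun k => ζ (reverseSteps v k)) · ω) (range n) (-x) := by
  have hreflect : ∀ i ∈ Ico u v, (if walk ζ i ω - walk ζ v ω = x then (1 : ℝ≥0∞) else 0) =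
      if walk (fun k => ζ (reverseSteps v k)) (v - i) ω = -x then 1 else 0 := fun i hi => by
    rw [walk_reverseSteps ζ (Nat.sub_le v i), Nat.sub_sub_self (mem_Ico.1 hi).2.le]
    simp_rw [neg_inj]
  rw [localTime, sum_congr rfl hreflect, ← sum_image (g := (v - ·))
    (f := fun k => if walk (fun k => ζ (reverseSteps v k)) k ω = -x then (1 : ℝ≥0∞) else 0)]
  · refine sum_le_sum_of_subset fun k hk => ?_
    obtain ⟨i, hi, rfl⟩ := mem_image.1 hk
    rw [mem_Ico] at hi
    exact mem_range.2 (by omega)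
  · intro i hi j hj hij
    simp only [coe_Ico, Set.mem_Ico] at hi hj hij
    omega

namespace HasIIDSteps

theorem lintegral_localTime_future_le (h : HasIIDSteps P ζ) (v n : ℕ) (x y : Fin 2 → ℤ) :
    ∫⁻ ω, localTime (fun i => walk ζ i ω - walk ζ v ω) (Ico v (v + n)) x *
        localTime (fun i => walk ζ i ω - walk ζ v ω) (Ico v (v + n)) y ∂P ≤
      green P ζ n x * green P ζ n (y - x) + green P ζ n y * green P ζ n (x - y) := by
  simp_rw [localTime_walk_sub_walk_future]
  have hσ : Function.Injective (v + ·) := add_right_injective v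
  simpa only [h.green_comp_injective hσ] using
    (h.comp_injective hσ).lintegral_localTime_mul_localTime_le n x y

theorem lintegral_localTime_past_le (h : HasIIDSteps P ζ) {u v n : ℕ} (hn : v < u + n)
    (x y : Fin 2 → ℤ) :
    ∫⁻ ω, localTime (fun i => walk ζ i ω - walk ζ v ω) (Ico u v) x *
        localTime (fun i => walk ζ i ω - walk ζ v ω) (Ico u v) y ∂P ≤
      green P ζ n (-x) * green P ζ n (-(y - x)) + green P ζ n (-y) * green P ζ n (-(x - y)) := by
  have hσ := reverseSteps_injective v
  have hbound := (h.comp_injective hσ).lintegral_localTime_mul_localTime_le n (-x) (-y)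
  rw [h.green_comp_injective hσ, neg_sub_neg, neg_sub_neg] at hbound
  rw [neg_sub, neg_sub]
  exact (lintegral_mono fun ω => mul_le_mul' (localTime_walk_sub_walk_past_le ζ hn ω x)
    (localTime_walk_sub_walk_past_le ζ hn ω y)).trans hbound

theorem indepFun_localTime (h : HasIIDSteps P ζ) {u v w : ℕ} (huv : u ≤ v) (hvw : v ≤ w) :
    IndepFun (fun ω => localTime (fun i => walk ζ i ω - walk ζ v ω) (Ico u v))
      (fun ω => localTime (fun i => walk ζ i ω - walk ζ v ω) (Ico v w)) P :=
  indepFun_of_dependsOn h.indep h.measurable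
    (dependsOn_localTime ⟨huv, le_rfl⟩) (dependsOn_localTime ⟨le_rfl, hvw⟩)
    (Ico_disjoint_Ico_consecutive u v w)

theorem indepFun_pairCount_Ico (h : HasIIDSteps P ζ) (u v w : ℕ) (l : Fin 2 → ℤ) :
    IndepFun (fun ω => pairCount (walk ζ · ω) (Ico u v) (Ico u v) l)
      (fun ω => pairCount (walk ζ · ω) (Ico v w) (Ico v w) l) P :=
  indepFun_of_dependsOn h.indep h.measurable
    (dependsOn_pairCount_Ico u v l) (dependsOn_pairCount_Ico v w l)
    (Ico_disjoint_Ico_consecutive u v w)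

end HasIIDSteps

end Blocks

section Variance

theorem variance_add_le {Ω : Type*} [MeasurableSpace Ω] {P : Measure Ω} [IsProbabilityMeasure P]
    {X Y : Ω → ℝ} (hX : MemLp X 2 P) (hY : MemLp Y 2 P) :
    Var[X + Y; P] ≤ 3 / 2 * Var[X; P] + 3 * Var[Y; P] := by
  have hsub := variance_nonneg (X - (2 : ℝ) • Y) P
  rw [variance_sub hX (hY.const_smul (2 : ℝ)), covariance_smul_right, variance_smul] at hsub
  rw [variance_add hX hY]
  linarith

theorem variance_add_le_integral_sq {Ω : Type*} [MeasurableSpace Ω] {P : Measure Ω}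
    [IsProbabilityMeasure P] {X Y : Ω → ℝ} (hX : MemLp X 2 P) (hY : MemLp Y 2 P) :
    Var[X + Y; P] ≤ 2 * ∫ ω, X ω ^ 2 ∂P + 2 * ∫ ω, Y ω ^ 2 ∂P := by
  have hX2 := hX.integrable_sq.const_mul 2
  have hY2 := hY.integrable_sq.const_mul 2
  calc Var[X + Y; P] ≤ ∫ ω, (X ω + Y ω) ^ 2 ∂P :=
        variance_le_expectation_sq (hX.add hY).aestronglyMeasurable
    _ ≤ ∫ ω, (2 * X ω ^ 2 + 2 * Y ω ^ 2) ∂P :=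
        integral_mono (hX.add hY).integrable_sq (hX2.add hY2) fun ω => by
          simpa only [mul_add] using add_sq_le (a := X ω) (b := Y ω)
    _ = _ := by rw [integral_add hX2 hY2, integral_const_mul, integral_const_mul]

/-- Halving an interval multiplies a quadratic bound by `(1/2)² + (1/2)² = 1/2 < 2/3`, up to the
rounding of the halves, so the error terms of the recursion sum to a geometric series. -/
theorem le_sq_of_halving {f : ℕ → ℕ → ℝ} {D : ℝ} (hD : 0 ≤ D) (hzero : ∀ u, f u 0 ≤ 0)
    (hone : ∀ u, f u 1 ≤ 0)
    (hadd : ∀ u a b, 0 < b → f u (a + b) ≤ 3 / 2 * (f u a + f (u + a) b) + D * (a + b : ℕ) ^ 2)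
    (n u : ℕ) : f u n ≤ 6 * D * n ^ 2 := by
  induction n using Nat.strong_induction_on generalizing u with
  | _ n ih =>
  rcases lt_or_ge n 2 with hn | hn
  · have hle : f u n ≤ 0 := by
      interval_cases n
      exacts [hzero u, hone u]
    exact hle.trans (by positivity)
  obtain ⟨a, b, ha, hb, rfl, hab⟩ : ∃ a b, 0 < a ∧ 0 < b ∧ a + b = n ∧
      9 * (a ^ 2 + b ^ 2) ≤ 5 * n ^ 2 := by
    rcases Nat.even_or_odd' n with ⟨k, rfl | rfl⟩
    · exact ⟨k, k, by omega, by omega, by ring, by nlinarith⟩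
    · have hk : 1 ≤ k := by omega
      exact ⟨k, k + 1, by omega, by omega, by ring, by nlinarith⟩
  have hab' : 9 * ((a : ℝ) ^ 2 + b ^ 2) ≤ 5 * ((a + b : ℕ) : ℝ) ^ 2 := by exact_mod_cast hab
  linarith [hadd u a b hb, ih a (by omega) u, ih b (by omega) (u + a),
    mul_le_mul_of_nonneg_left hab' hD]

variable {Ω : Type*} [MeasurableSpace Ω] {P : Measure Ω} {ζ : ℕ → Ω → (Fin 2 → ℤ)}

theorem HasIIDSteps.measurable_localTime_sub (h : HasIIDSteps P ζ) (v : ℕ) (A : Finset ℕ)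
    (x : Fin 2 → ℤ) : Measurable fun ω => localTime (fun i => walk ζ i ω - walk ζ v ω) A x :=
  Finset.measurable_fun_sum _ fun i _ =>
    .ite (h.measurableSet_walk_sub_walk_eq i v x) measurable_const measurable_const

theorem green_mono {m n : ℕ} (hmn : m ≤ n) (x : Fin 2 → ℤ) : green P ζ m x ≤ green P ζ n x :=
  sum_le_sum_of_subset (range_subset_range.2 hmn)

theorem HasIIDSteps.lintegral_pairCount_sq (h : HasIIDSteps P ζ) {u v w : ℕ} (huv : u ≤ v)
    (hvw : v ≤ w) (l : Fin 2 → ℤ) :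
    ∫⁻ ω, ENNReal.ofReal (pairCount (walk ζ · ω) (Ico u v) (Ico v w) l) ^ 2 ∂P =
      ∑' x, ∑' y,
        (∫⁻ ω, localTime (fun i => walk ζ i ω - walk ζ v ω) (Ico u v) x *
          localTime (fun i => walk ζ i ω - walk ζ v ω) (Ico u v) y ∂P) *
        ∫⁻ ω, localTime (fun i => walk ζ i ω - walk ζ v ω) (Ico v w) (x - l) *
          localTime (fun i => walk ζ i ω - walk ζ v ω) (Ico v w) (y - l) ∂P := by
  set L := fun ω => localTime (fun i => walk ζ i ω - walk ζ v ω) (Ico u v)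
  set R := fun ω => localTime (fun i => walk ζ i ω - walk ζ v ω) (Ico v w)
  have hL : ∀ x, Measurable (L · x) := h.measurable_localTime_sub v (Ico u v)
  have hR : ∀ x, Measurable (R · x) := h.measurable_localTime_sub v (Ico v w)
  have hindep : ∀ x y, ∫⁻ ω, L ω x * L ω y * (R ω (x - l) * R ω (y - l)) ∂P =
      (∫⁻ ω, L ω x * L ω y ∂P) * ∫⁻ ω, R ω (x - l) * R ω (y - l) ∂P := fun x y =>
    lintegral_mul_eq_lintegral_mul_lintegral_of_indepFun ((hL x).mul (hL y))
      ((hR (x - l)).mul (hR (y - l))) ((h.indepFun_localTime huv hvw).comp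
        (φ := fun r : (Fin 2 → ℤ) → ℝ≥0∞ => r x * r y)
        (ψ := fun r : (Fin 2 → ℤ) → ℝ≥0∞ => r (x - l) * r (y - l)) (by fun_prop) (by fun_prop))
  have hexpand : ∀ ω, ENNReal.ofReal (pairCount (walk ζ · ω) (Ico u v) (Ico v w) l) ^ 2 =
      ∑' x, ∑' y, L ω x * L ω y * (R ω (x - l) * R ω (y - l)) := fun ω => by
    rw [ofReal_pairCount _ _ _ _ (walk ζ v ω), sq, ← ENNReal.tsum_mul_right]
    refine tsum_congr fun x => ?_
    rw [← ENNReal.tsum_mul_left]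
    exact tsum_congr fun y => mul_mul_mul_comm _ _ _ _
  have hmeas : ∀ x y, Measurable fun ω => L ω x * L ω y * (R ω (x - l) * R ω (y - l)) :=
    fun x y => ((hL x).mul (hL y)).mul ((hR (x - l)).mul (hR (y - l)))
  refine Eq.trans ?_ (tsum_congr fun x => tsum_congr fun y => hindep x y)
  simp_rw [hexpand]
  rw [lintegral_tsum fun x => (Measurable.tsum (hmeas x)).aemeasurable]
  simp_rw [lintegral_tsum fun y => (hmeas _ y).aemeasurable]

theorem HasIIDSteps.lintegral_pairCount_sq_le (h : HasIIDSteps P ζ) {u v b n : ℕ} (huv : u ≤ v)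
    (hn : v < u + n) (hb : b ≤ n) (l : Fin 2 → ℤ) :
    ∫⁻ ω, ENNReal.ofReal (pairCount (walk ζ · ω) (Ico u v) (Ico v (v + b)) l) ^ 2 ∂P ≤
      12 * (∑' x, green P ζ n x ^ 2) ^ 2 := by
  have hpast := tsum_tsum_sq_le_of_le_mul_sub (a := fun x => green P ζ n (-x))
    (b := fun x => green P ζ n (-x)) fun x y => h.lintegral_localTime_past_le hn x y
  have hfuture := tsum_tsum_sq_le_of_le_mul_sub (a := fun x => green P ζ n (x - l))
    (b := green P ζ n) fun x y =>
      (h.lintegral_localTime_future_le v b (x - l) (y - l)).trans <| by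
        rw [sub_sub_sub_cancel_right, sub_sub_sub_cancel_right]
        gcongr <;> exact green_mono hb _
  have hneg : ∑' x, green P ζ n (-x) ^ 2 = ∑' x, green P ζ n x ^ 2 :=
    (Equiv.neg _).tsum_eq fun x => green P ζ n x ^ 2
  have htranslate : ∑' x, green P ζ n (x - l) ^ 2 = ∑' x, green P ζ n x ^ 2 :=
    (Equiv.subRight l).tsum_eq fun x => green P ζ n x ^ 2
  rw [h.lintegral_pairCount_sq huv (Nat.le_add_right v b)]
  calc _ ≤ _ := ENNReal.tsum_le_tsum fun x => ENNReal.tsum_le_tsum fun y =>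
        ennreal_mul_le_sq_add_sq _ _
    _ ≤ _ := by
        simp_rw [ENNReal.tsum_add]
        exact add_le_add hpast hfuture
    _ = 12 * (∑' x, green P ζ n x ^ 2) ^ 2 := by
        rw [hneg, htranslate]
        ring

theorem IsPlanarWalk.exists_integral_pairCount_sq_le (h : IsPlanarWalk P ζ) :
    ∃ K : ℝ, 0 ≤ K ∧ ∀ u a b l, 0 < b →
      ∫ ω, pairCount (walk ζ · ω) (Ico u (u + a)) (Ico (u + a) (u + a + b)) l ^ 2 ∂P ≤
        K * (a + b : ℕ) ^ 2 := by
  obtain ⟨K, hK⟩ := h.exists_tsum_green_sq_le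
  refine ⟨12 * K ^ 2, by positivity, fun u a b l hb => ?_⟩
  have hle := (h.lintegral_pairCount_sq_le (n := a + b) (Nat.le_add_right u a) (by omega)
    (Nat.le_add_left b a) l).trans
    (mul_le_mul_right (pow_le_pow_left₀ zero_le (hK (a + b)) 2) 12)
  simp_rw [← ENNReal.ofReal_pow (pairCount_nonneg _ _ _ _)] at hle
  rw [← ofReal_integral_eq_lintegral_ofReal (h.memLp_pairCount _ _ _ 2).integrable_sq
    (ae_of_all _ fun _ => sq_nonneg _)] at hle
  refine (ENNReal.ofReal_le_iff_le_toReal (by finiteness)).1 hle |>.trans_eq ?_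
  rw [ENNReal.toReal_mul, ENNReal.toReal_pow, ENNReal.toReal_mul, ENNReal.coe_toReal,
    ENNReal.toReal_natCast, ENNReal.toReal_ofNat]
  ring

theorem IsPlanarWalk.exists_variance_pairCount_Ico_le (h : IsPlanarWalk P ζ) (l : Fin 2 → ℤ) :
    ∃ K : ℝ, ∀ n u : ℕ,
      Var[fun ω => pairCount (walk ζ · ω) (Ico u (u + n)) (Ico u (u + n)) l; P] ≤ K * n ^ 2 := by
  have := h.isProbabilityMeasure
  obtain ⟨K, hK, hcross⟩ := h.exists_integral_pairCount_sq_le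
  have hconst : ∀ c : ℝ, Var[fun _ => c; P] = 0 := fun c => by
    rw [variance_eq_integral aemeasurable_const]
    simp
  refine ⟨6 * (3 * (4 * K)), le_sq_of_halving (by positivity) (fun u => ?_) (fun u => ?_)
    fun u a b hb => ?_⟩
  · simp [pairCount, hconst]
  · simp [pairCount_singleton_self, hconst]
  have hmem := fun A B l => h.memLp_pairCount A B l 2
  have hdiag := (h.indepFun_pairCount_Ico u (u + a) (u + a + b) l).variance_add
    (hmem _ _ _) (hmem _ _ _)
  have hoff := variance_add_le_integral_sq (hmem (Ico u (u + a)) (Ico (u + a) (u + a + b)) l)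
    (hmem (Ico u (u + a)) (Ico (u + a) (u + a + b)) (-l))
  have hsplit := variance_add_le ((hmem (Ico u (u + a)) (Ico u (u + a)) l).add
      (hmem (Ico (u + a) (u + a + b)) (Ico (u + a) (u + a + b)) l))
    ((hmem (Ico u (u + a)) (Ico (u + a) (u + a + b)) l).add
      (hmem (Ico u (u + a)) (Ico (u + a) (u + a + b)) (-l)))
  simp_rw [← add_assoc u a b,
    pairCount_Ico_split _ (Nat.le_add_right u a) (Nat.le_add_right (u + a) b)]
  refine hsplit.trans ?_
  linarith [hcross u a b l hb, hcross u a b (-l) hb]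

end Variance

theorem ae_tendsto_zero_of_summable_integral_sq {Ω : Type*} [MeasurableSpace Ω] {P : Measure Ω}
    {Y : ℕ → Ω → ℝ} (hY : ∀ k, MemLp (Y k) 2 P) (hsum : Summable fun k => ∫ ω, Y k ω ^ 2 ∂P) :
    ∀ᵐ ω ∂P, Tendsto (fun k => Y k ω) atTop (𝓝 0) := by
  have hmeas : ∀ k, AEMeasurable (fun ω => ENNReal.ofReal (Y k ω ^ 2)) P := fun k =>
    ((hY k).aestronglyMeasurable.aemeasurable.pow_const 2).ennreal_ofReal
  have hfin : ∫⁻ ω, ∑' k, ENNReal.ofReal (Y k ω ^ 2) ∂P ≠ ∞ := by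
    rw [lintegral_tsum hmeas]
    simp_rw [← ofReal_integral_eq_lintegral_ofReal (hY _).integrable_sq
      (ae_of_all _ fun _ => sq_nonneg _)]
    exact hsum.tsum_ofReal_ne_top
  filter_upwards [ae_lt_top' (AEMeasurable.tsum hmeas) hfin] with ω hω
  have hsq : Tendsto (fun k => Y k ω ^ 2) atTop (𝓝 0) := by
    simpa [Function.comp_def, ENNReal.toReal_ofReal (sq_nonneg _)] using
      (ENNReal.tendsto_toReal ENNReal.zero_ne_top).comp
        (ENNReal.tendsto_atTop_zero_of_tsum_ne_top hω.ne)
  rw [tendsto_zero_iff_abs_tendsto_zero]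
  simpa [Function.comp_def, Real.sqrt_sq_eq_abs] using hsq.sqrt

theorem tendsto_mul_log_div_mul_log {ι : Type*} {f : Filter ι} {u v : ι → ℝ} {ρ : ℝ} (hρ : 0 < ρ)
    (hv : Tendsto v f atTop) (huv : Tendsto (fun i => u i / v i) f (𝓝 ρ)) :
    Tendsto (fun i => u i * Real.log (u i) / (v i * Real.log (v i))) f (𝓝 ρ) := by
  have hlogv : Tendsto (fun i => Real.log (v i)) f atTop := Real.tendsto_log_atTop.comp hv
  have hlog : Tendsto (fun i => Real.log (u i) / Real.log (v i)) f (𝓝 1) := by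
    have hquot := ((huv.log hρ.ne').div_atTop hlogv).add_const 1
    rw [zero_add] at hquot
    refine hquot.congr' ?_
    filter_upwards [hlogv.eventually_gt_atTop 0, hv.eventually_gt_atTop 0,
      huv.eventually (lt_mem_nhds hρ)] with i hlogi hvi hi
    have hui : u i ≠ 0 := fun h0 => by simp [h0] at hi
    rw [Real.log_div hui hvi.ne']
    field_simp
    ring
  simpa only [mul_one, div_mul_div_comm] using huv.mul hlog

theorem tendsto_atTop_of_tendsto_div {ι : Type*} {f : Filter ι} {u v : ι → ℝ} {ρ : ℝ} (hρ : 0 < ρ)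
    (hv : Tendsto v f atTop) (huv : Tendsto (fun i => u i / v i) f (𝓝 ρ)) :
    Tendsto u f atTop :=
  (huv.pos_mul_atTop hρ hv).congr' <| (hv.eventually_ne_atTop 0).mono fun _ hi =>
    div_mul_cancel₀ _ hi

theorem tendsto_floor_mul_sub_floor_mul_div {s t : ℝ} (hs : 0 ≤ s) (hst : s ≤ t) :
    Tendsto (fun x : ℝ => ((⌊x * t⌋₊ - ⌊x * s⌋₊ : ℕ) : ℝ) / x) atTop (𝓝 (t - s)) := by
  refine ((tendsto_nat_floor_mul_div_atTop (hs.trans hst)).sub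
    (tendsto_nat_floor_mul_div_atTop hs)).congr' ?_
  filter_upwards [eventually_ge_atTop 0] with x hx
  rw [Nat.cast_sub (Nat.floor_mono (by gcongr)), sub_div, mul_comm t, mul_comm s]

section BlockPairCount

variable {G : Type*} [AddCommGroup G] [DecidableEq G]

/-- The number of pairs of times in the dilated interval `[x * s, x * t)` between which the sequence
`z` makes the displacement `l`. The dilation factor `x` is real so as to allow arbitrary scales. -/
noncomputable def blockPairCount (z : ℕ → G) (l : G) (s t x : ℝ) : ℝ :=
  pairCount z (Ico ⌊x * s⌋₊ ⌊x * t⌋₊) (Ico ⌊x * s⌋₊ ⌊x * t⌋₊) l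

theorem blockPairCount_le_blockPairCount (z : ℕ → G) (l : G) {s t x s' t' x' : ℝ}
    (hs : x' * s' ≤ x * s) (ht : x * t ≤ x' * t') :
    blockPairCount z l s t x ≤ blockPairCount z l s' t' x' := by
  have hsub := Ico_subset_Ico (Nat.floor_mono hs) (Nat.floor_mono ht)
  exact pairCount_mono z hsub hsub l

end BlockPairCount

section AlmostSureAlongScales

variable {Ω : Type*} [MeasurableSpace Ω] {P : Measure Ω} {ζ : ℕ → Ω → (Fin 2 → ℤ)}

theorem HasIIDSteps.memLp_blockPairCount (h : HasIIDSteps P ζ) (l : Fin 2 → ℤ) (s t x : ℝ)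
    (p : ℝ≥0∞) : MemLp (fun ω => blockPairCount (walk ζ · ω) l s t x) p P :=
  h.memLp_pairCount _ _ l p

namespace IsPlanarWalk

theorem tendsto_integral_blockPairCount (h : IsPlanarWalk P ζ) (l : Fin 2 → ℤ) {s t : ℝ}
    (hs : 0 ≤ s) (hst : s < t) :
    Tendsto (fun x : ℝ =>
        (x * Real.log x)⁻¹ * ∫ ω, blockPairCount (walk ζ · ω) l s t x ∂P)
      atTop (𝓝 (selfIntersectionConst (covMatrix P (ζ 0)) * (t - s))) := by
  have hlen := tendsto_floor_mul_sub_floor_mul_div hs hst.le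
  have hlenTop := tendsto_atTop_of_tendsto_div (sub_pos.2 hst) tendsto_id hlen
  refine (((h.tendsto_integral_pairCount_Ico 0 l).comp
    (tendsto_natCast_atTop_iff.1 hlenTop)).mul
    (tendsto_mul_log_div_mul_log (sub_pos.2 hst) tendsto_id hlen)).congr' ?_
  filter_upwards [eventually_ge_atTop 0, hlenTop.eventually_gt_atTop 1] with x hx hlenx
  have hfloor : ⌊x * s⌋₊ ≤ ⌊x * t⌋₊ := Nat.floor_mono (by gcongr)
  have hlog := Real.log_pos hlenx
  have hmean := h.integral_pairCount_Ico ⌊x * s⌋₊ (⌊x * t⌋₊ - ⌊x * s⌋₊) l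
  rw [← h.integral_pairCount_Ico 0, Nat.add_sub_cancel' hfloor] at hmean
  simp only [Function.comp_apply, id_eq, blockPairCount, ← hmean]
  field_simp

theorem exists_variance_blockPairCount_le (h : IsPlanarWalk P ζ) (l : Fin 2 → ℤ) :
    ∃ K : ℝ, ∀ s t x : ℝ, s ≤ t → 0 ≤ t → 0 ≤ x →
      Var[fun ω => blockPairCount (walk ζ · ω) l s t x; P] ≤ K * (x * t) ^ 2 := by
  obtain ⟨K, hK⟩ := h.exists_variance_pairCount_Ico_le l
  have hK0 : 0 ≤ K := by simpa using (variance_nonneg _ _).trans (hK 1 0)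
  refine ⟨K, fun s t x hst ht hx => ?_⟩
  have hfloor : ⌊x * s⌋₊ ≤ ⌊x * t⌋₊ := Nat.floor_mono (by gcongr)
  have hvar := hK (⌊x * t⌋₊ - ⌊x * s⌋₊) ⌊x * s⌋₊
  rw [Nat.add_sub_cancel' hfloor] at hvar
  have hlen : ((⌊x * t⌋₊ - ⌊x * s⌋₊ : ℕ) : ℝ) ≤ x * t :=
    (Nat.cast_le.2 (Nat.sub_le _ _)).trans (Nat.floor_le (by positivity))
  exact hvar.trans (by gcongr)

theorem ae_tendsto_blockPairCount (h : IsPlanarWalk P ζ) (l : Fin 2 → ℤ) {s t : ℝ} (hs : 0 ≤ s)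
    (hst : s < t) {r : ℕ → ℝ} (hr : Tendsto r atTop atTop) (hr0 : ∀ k, 0 < r k)
    (hsum : Summable fun k => (Real.log (r k) ^ 2)⁻¹) :
    ∀ᵐ ω ∂P, Tendsto
      (fun k => (r k * Real.log (r k))⁻¹ * blockPairCount (walk ζ · ω) l s t (r k))
      atTop (𝓝 (selfIntersectionConst (covMatrix P (ζ 0)) * (t - s))) := by
  have := h.isProbabilityMeasure
  obtain ⟨K, hK⟩ := h.exists_variance_blockPairCount_le l
  have hmem := fun k => h.memLp_blockPairCount l s t (r k) 2
  have hfluct := ae_tendsto_zero_of_summable_integral_sq (P := P)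
    (Y := fun k ω => (r k * Real.log (r k))⁻¹ * (blockPairCount (walk ζ · ω) l s t (r k) -
      ∫ ω', blockPairCount (walk ζ · ω') l s t (r k) ∂P))
    (fun k => ((hmem k).sub (memLp_const _)).const_mul _)
    (Summable.of_nonneg_of_le (fun k => integral_nonneg fun ω => sq_nonneg _) (fun k => ?_)
      (hsum.mul_left (K * t ^ 2)))
  · filter_upwards [hfluct] with ω hω
    simpa [mul_sub, Function.comp_def] using
      hω.add ((h.tendsto_integral_blockPairCount l hs hst).comp hr)
  · simp_rw [mul_pow]
    rw [integral_const_mul, ← variance_eq_integral (hmem k).aestronglyMeasurable.aemeasurable]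
    calc _ ≤ ((r k * Real.log (r k))⁻¹) ^ 2 * (K * (r k * t) ^ 2) := by
          gcongr
          exact hK s t (r k) hst.le (hs.trans hst.le) (hr0 k).le
      _ = K * t ^ 2 * (Real.log (r k) ^ 2)⁻¹ := by
          field_simp [(hr0 k).ne']

end IsPlanarWalk

end AlmostSureAlongScales

theorem tendsto_rpow_sub_floor_rpow {p : ℝ} (hp0 : 0 ≤ p) (hp1 : p < 1) :
    Tendsto (fun y : ℝ => y ^ p - (⌊y⌋₊ : ℝ) ^ p) atTop (𝓝 0) := by
  have hfloor : Tendsto (fun y : ℝ => (⌊y⌋₊ : ℝ)) atTop atTop :=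
    tendsto_natCast_atTop_atTop.comp tendsto_nat_floor_atTop
  refine squeeze_zero' ?_ ?_ ((tendsto_rpow_neg_atTop (sub_pos.2 hp1)).comp hfloor)
  · filter_upwards [eventually_ge_atTop 0] with y hy
    exact sub_nonneg.2 (Real.rpow_le_rpow (Nat.cast_nonneg _) (Nat.floor_le hy) hp0)
  · filter_upwards [eventually_ge_atTop 0, hfloor.eventually_gt_atTop 0] with y hy hm
    set m : ℝ := (⌊y⌋₊ : ℝ)
    have hbernoulli : (1 + 1 / m) ^ p ≤ 1 + p * (1 / m) :=
      rpow_one_add_le_one_add_mul_self (by have := one_div_pos.2 hm; linarith) hp0 hp1.le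
    rw [Function.comp_apply, sub_le_iff_le_add', neg_sub, Real.rpow_sub_one hm.ne']
    calc y ^ p ≤ (m * (1 + 1 / m)) ^ p := by
          gcongr
          rw [mul_add, mul_one_div_cancel hm.ne', mul_one]
          exact (Nat.lt_floor_add_one y).le
      _ = m ^ p * (1 + 1 / m) ^ p := Real.mul_rpow hm.le (by positivity)
      _ ≤ m ^ p * (1 + 1 * (1 / m)) := by
          gcongr
          exact hbernoulli.trans (by gcongr)
      _ = m ^ p + m ^ p / m := by ring

/-- The scales along which almost sure convergence is first proved: they grow fast enough for
Borel–Cantelli, while the ratio of consecutive ones tends to `1`. -/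
noncomputable def stretchedExp (k : ℕ) : ℝ :=
  Real.exp ((k : ℝ) ^ (3 / 4 : ℝ))

theorem tendsto_stretchedExp : Tendsto stretchedExp atTop atTop :=
  Real.tendsto_exp_atTop.comp
    ((tendsto_rpow_atTop (by norm_num)).comp tendsto_natCast_atTop_atTop)

theorem summable_inv_sq_log_stretchedExp :
    Summable fun k => (Real.log (stretchedExp k) ^ 2)⁻¹ := by
  simp_rw [stretchedExp, Real.log_exp, ← Real.rpow_natCast, ← Real.rpow_mul (Nat.cast_nonneg _)]
  exact Real.summable_nat_rpow_inv.2 (by norm_num)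

theorem exists_tendsto_stretchedExp_div :
    ∃ κ : ℕ → ℕ, Tendsto κ atTop atTop ∧
      Tendsto (fun n : ℕ => stretchedExp (κ n) / n) atTop (𝓝 1) := by
  have hpow : Tendsto (fun n : ℕ => Real.log n ^ (4 / 3 : ℝ)) atTop atTop :=
    (tendsto_rpow_atTop (by norm_num)).comp tendsto_log_natCast_atTop
  refine ⟨fun n => ⌊Real.log n ^ (4 / 3 : ℝ)⌋₊, tendsto_nat_floor_atTop.comp hpow, ?_⟩
  have hlim := ((tendsto_rpow_sub_floor_rpow (p := 3 / 4) (by norm_num) (by norm_num)).comp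
    hpow).neg.rexp
  rw [neg_zero, Real.exp_zero] at hlim
  refine hlim.congr' ?_
  filter_upwards [eventually_gt_atTop 0] with n hn
  have hlog : (Real.log n ^ (4 / 3 : ℝ)) ^ (3 / 4 : ℝ) = Real.log n := by
    rw [← Real.rpow_mul (Real.log_natCast_nonneg n)]
    norm_num
  rw [Function.comp_apply, neg_sub, hlog, Real.exp_sub, Real.exp_log (Nat.cast_pos.2 hn),
    stretchedExp]

/-- The sequence `z` makes every displacement, within the dilated interval `[n * s, n * t)`, about
`C * (t - s) * n * log n` times. -/
def HasBlockAsymptotics {G : Type*} [AddCommGroup G] [DecidableEq G] (z : ℕ → G) (C : ℝ) : Prop :=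
  ∀ (l : G) (s t : ℝ), 0 ≤ s → s ≤ t →
    Tendsto (fun n : ℕ => (n * Real.log n)⁻¹ * blockPairCount z l s t n) atTop (𝓝 (C * (t - s)))

theorem eventually_mul_le_mul_of_tendsto_div {ι : Type*} {f : Filter ι} {u v : ι → ℝ}
    (hv : ∀ᶠ i in f, 0 < v i) (huv : Tendsto (fun i => u i / v i) f (𝓝 1)) {a b : ℝ} (hab : a < b) :
    ∀ᶠ i in f, u i * a ≤ v i * b := by
  have hlim := huv.mul_const a
  rw [one_mul] at hlim
  filter_upwards [hv, hlim.eventually (gt_mem_nhds hab)] with i hvi hi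
  rw [div_mul_eq_mul_div, div_lt_iff₀' hvi] at hi
  exact hi.le

section Interpolation

variable {G : Type*} [AddCommGroup G] [DecidableEq G] {z : ℕ → G} {l : G} {C : ℝ} {m : ℕ → ℝ}

theorem eventually_lt_blockPairCount (hm : Tendsto (fun n : ℕ => m n / n) atTop (𝓝 1))
    (hz : ∀ s t : ℚ, 0 ≤ s → s < t → Tendsto
      (fun n : ℕ => (n * Real.log n)⁻¹ * blockPairCount z l s t (m n)) atTop (𝓝 (C * (t - s))))
    {s t c : ℝ} (hs : 0 ≤ s) (hst : s < t) (hc : c < C * (t - s)) :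
    ∀ᶠ n : ℕ in atTop, c < (n * Real.log n)⁻¹ * blockPairCount z l s t n := by
  have hnat := tendsto_natCast_atTop_atTop (R := ℝ)
  have hmTop := tendsto_atTop_of_tendsto_div one_pos hnat hm
  have hm' : Tendsto (fun n : ℕ => n / m n) atTop (𝓝 1) := by simpa using hm.inv₀ one_ne_zero
  obtain ⟨σ, -, hsσ, hσ⟩ := Real.exists_seq_rat_strictAnti_tendsto s
  obtain ⟨τ, -, hτt, hτ⟩ := Real.exists_seq_rat_strictMono_tendsto t
  have hστ := hσ.eventually_lt hτ hst
  obtain ⟨j, hcj, hj⟩ := ((((hτ.sub hσ).const_mul C).eventually (lt_mem_nhds hc)).and hστ).exists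
  have hσ0 : 0 ≤ σ j := by exact_mod_cast hs.trans (hsσ j).le
  filter_upwards [(hz _ _ hσ0 (Rat.cast_lt.1 hj)).eventually (lt_mem_nhds hcj),
    eventually_mul_le_mul_of_tendsto_div (hmTop.eventually_gt_atTop 0) hm' (hsσ j),
    eventually_mul_le_mul_of_tendsto_div (hnat.eventually_gt_atTop 0) hm (hτt j)]
    with n hn hleft hright
  exact hn.trans_le (by gcongr; exact blockPairCount_le_blockPairCount z l hleft hright)

theorem eventually_blockPairCount_lt (hm : Tendsto (fun n : ℕ => m n / n) atTop (𝓝 1))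
    (hz : ∀ s t : ℚ, 0 ≤ s → s < t → Tendsto
      (fun n : ℕ => (n * Real.log n)⁻¹ * blockPairCount z l s t (m n)) atTop (𝓝 (C * (t - s))))
    {s t c : ℝ} (hs : 0 ≤ s) (hst : s < t) (hc : C * (t - s) < c) :
    ∀ᶠ n : ℕ in atTop, (n * Real.log n)⁻¹ * blockPairCount z l s t n < c := by
  have hnat := tendsto_natCast_atTop_atTop (R := ℝ)
  have hmTop := tendsto_atTop_of_tendsto_div one_pos hnat hm
  have hm' : Tendsto (fun n : ℕ => n / m n) atTop (𝓝 1) := by simpa using hm.inv₀ one_ne_zero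
  obtain ⟨σ, -, hσs, hσ⟩ := Real.exists_seq_rat_strictMono_tendsto s
  obtain ⟨τ, -, htτ, hτ⟩ := Real.exists_seq_rat_strictAnti_tendsto t
  have hσ' : Tendsto (fun j => ((max (σ j) 0 : ℚ) : ℝ)) atTop (𝓝 s) := by
    simpa [max_eq_left hs] using hσ.max (tendsto_const_nhds (x := (0 : ℝ)))
  have hστ := hσ'.eventually_lt hτ hst
  obtain ⟨j, hcj, hj⟩ := ((((hτ.sub hσ').const_mul C).eventually (gt_mem_nhds hc)).and hστ).exists
  filter_upwards [(hz _ _ (le_max_right _ _) (Rat.cast_lt.1 hj)).eventually (gt_mem_nhds hcj),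
    hmTop.eventually_gt_atTop 0,
    eventually_mul_le_mul_of_tendsto_div (hnat.eventually_gt_atTop 0) hm (hσs j),
    eventually_mul_le_mul_of_tendsto_div (hmTop.eventually_gt_atTop 0) hm' (htτ j)]
    with n hn hmn hleft hright
  have hleft' : m n * (max (σ j) 0 : ℚ) ≤ n * s := by
    rw [Rat.cast_max, mul_max_of_nonneg _ _ hmn.le, Rat.cast_zero, mul_zero]
    exact max_le hleft (by positivity)
  exact lt_of_le_of_lt (by gcongr; exact blockPairCount_le_blockPairCount z l hleft' hright) hn

theorem tendsto_blockPairCount_of_scale (hm : Tendsto (fun n : ℕ => m n / n) atTop (𝓝 1))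
    (hz : ∀ s t : ℚ, 0 ≤ s → s < t → Tendsto
      (fun n => (m n * Real.log (m n))⁻¹ * blockPairCount z l s t (m n)) atTop (𝓝 (C * (t - s))))
    {s t : ℝ} (hs : 0 ≤ s) (hst : s ≤ t) :
    Tendsto (fun n : ℕ => (n * Real.log n)⁻¹ * blockPairCount z l s t n) atTop
      (𝓝 (C * (t - s))) := by
  have hnat := tendsto_natCast_atTop_atTop (R := ℝ)
  have hz' : ∀ s t : ℚ, 0 ≤ s → s < t → Tendsto
      (fun n : ℕ => (n * Real.log n)⁻¹ * blockPairCount z l s t (m n)) atTop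
      (𝓝 (C * (t - s))) := fun s t hs hst => by
    have hlim := (hz s t hs hst).mul (tendsto_mul_log_div_mul_log one_pos hnat hm)
    rw [mul_one] at hlim
    refine hlim.congr' ?_
    filter_upwards [(tendsto_atTop_of_tendsto_div one_pos hnat hm).eventually_gt_atTop 1] with n hn
    have hlog := Real.log_pos hn
    field_simp
  rcases hst.eq_or_lt with rfl | hst
  · simp [blockPairCount, pairCount]
  · exact tendsto_order.2 ⟨fun c hc => eventually_lt_blockPairCount hm hz' hs hst hc,
      fun c hc => eventually_blockPairCount_lt hm hz' hs hst hc⟩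

end Interpolation

theorem IsPlanarWalk.ae_hasBlockAsymptotics {Ω : Type*} [MeasurableSpace Ω] {P : Measure Ω}
    {ζ : ℕ → Ω → (Fin 2 → ℤ)} (h : IsPlanarWalk P ζ) :
    ∀ᵐ ω ∂P, HasBlockAsymptotics (walk ζ · ω) (selfIntersectionConst (covMatrix P (ζ 0))) := by
  have hscale : ∀ᵐ ω ∂P, ∀ l, ∀ s t : ℚ, 0 ≤ s → s < t → Tendsto
      (fun k => (stretchedExp k * Real.log (stretchedExp k))⁻¹ *
        blockPairCount (walk ζ · ω) l s t (stretchedExp k)) atTop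
      (𝓝 (selfIntersectionConst (covMatrix P (ζ 0)) * (t - s))) := by
    simp_rw [eventually_countable_forall]
    exact fun l s t hs hst => h.ae_tendsto_blockPairCount l (by exact_mod_cast hs)
      (by exact_mod_cast hst) tendsto_stretchedExp (fun _ => Real.exp_pos _)
      summable_inv_sq_log_stretchedExp
  obtain ⟨κ, hκ, hκ1⟩ := exists_tendsto_stretchedExp_div
  filter_upwards [hscale] with ω hω l s t hs hst
  exact tendsto_blockPairCount_of_scale hκ1 (fun s t hs hst => (hω l s t hs hst).comp hκ) hs hst

section Blocks

variable {G : Type*} [AddCommGroup G] [DecidableEq G] {z : ℕ → G} {C : ℝ}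

theorem pairCount_Icc_le (z : ℕ → G) (a b a' b' : ℕ) (l : G) :
    pairCount z (Icc a b) (Icc a' b') l ≤
      pairCount z (Ico a b) (Ico a' b') l + (b + b' + 1) := by
  have hsub : ∀ a b : ℕ, Icc a b ⊆ Ico a b ∪ {b} := fun a b k => by
    simp only [mem_Icc, mem_union, mem_Ico, mem_singleton]
    omega
  have hdisj : ∀ a b : ℕ, Disjoint (Ico a b) {b} := fun a b => by simp
  have hrow := pairCount_le_card z {b} (Ico a' b' ∪ {b'}) l
  have hcol := pairCount_le_card z (Ico a b) {b'} l
  have hlen : ∀ a b : ℕ, ((b - a : ℕ) : ℝ) ≤ b := fun a b => Nat.cast_le.2 (Nat.sub_le b a)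
  rw [card_union_of_disjoint (hdisj a' b')] at hrow
  simp only [card_singleton, Nat.card_Ico, Nat.cast_one, one_mul, mul_one,
    Nat.cast_add] at hrow hcol
  calc _ ≤ _ := pairCount_mono z (hsub a b) (hsub a' b') l
    _ = pairCount z (Ico a b) (Ico a' b') l + pairCount z (Ico a b) {b'} l +
        pairCount z {b} (Ico a' b' ∪ {b'}) l := by
      rw [pairCount_union_left z (hdisj a b), pairCount_union_right z (Ico a b) (hdisj a' b')]
    _ ≤ _ := by linarith [hlen a b, hlen a' b']

theorem tendsto_floor_add_floor_add_one_div_mul_log {t t' : ℝ} (ht : 0 ≤ t) (ht' : 0 ≤ t') :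
    Tendsto (fun n : ℕ => (n * Real.log n)⁻¹ * (⌊n * t⌋₊ + ⌊n * t'⌋₊ + 1)) atTop (𝓝 0) := by
  have hnat := tendsto_natCast_atTop_atTop (R := ℝ)
  refine ((((tendsto_nat_floor_mul_div_atTop ht).comp hnat).add
    ((tendsto_nat_floor_mul_div_atTop ht').comp hnat)).add
    (tendsto_inv_atTop_zero.comp hnat)).div_atTop tendsto_log_natCast_atTop |>.congr fun n => ?_
  simp only [Function.comp_apply, mul_comm t, mul_comm t']
  ring

namespace HasBlockAsymptotics

theorem tendsto_pairCount_consecutive (hz : HasBlockAsymptotics z C) (l : G) {s u v : ℝ}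
    (hs : 0 ≤ s) (hsu : s ≤ u) (huv : u ≤ v) :
    Tendsto (fun n : ℕ => (n * Real.log n)⁻¹ *
      pairCount z (Ico ⌊n * s⌋₊ ⌊n * u⌋₊) (Ico ⌊n * u⌋₊ ⌊n * v⌋₊) l) atTop (𝓝 0) := by
  have hlim := ((hz l s v hs (hsu.trans huv)).sub (hz l s u hs hsu)).sub
    (hz l u v (hs.trans hsu) huv)
  rw [← mul_sub, ← mul_sub, sub_sub_sub_cancel_right, sub_self, mul_zero] at hlim
  refine squeeze_zero (fun n => ?_) (fun n => ?_) hlim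
  · have := pairCount_nonneg z (Ico ⌊n * s⌋₊ ⌊n * u⌋₊) (Ico ⌊n * u⌋₊ ⌊n * v⌋₊) l
    positivity
  · have hfloor : ⌊n * s⌋₊ ≤ ⌊n * u⌋₊ ∧ ⌊n * u⌋₊ ≤ ⌊n * v⌋₊ :=
      ⟨Nat.floor_mono (by gcongr), Nat.floor_mono (by gcongr)⟩
    have hneg := pairCount_nonneg z (Ico ⌊n * s⌋₊ ⌊n * u⌋₊) (Ico ⌊n * u⌋₊ ⌊n * v⌋₊) (-l)
    rw [← mul_sub, ← mul_sub, blockPairCount, blockPairCount, blockPairCount,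
      pairCount_Ico_split z hfloor.1 hfloor.2]
    gcongr
    linarith

theorem tendsto_pairCount_of_le (hz : HasBlockAsymptotics z C) (l : G) {s t s' t' : ℝ}
    (hs : 0 ≤ s) (hst : s ≤ t) (hts' : t ≤ s') (hst' : s' ≤ t') :
    Tendsto (fun n : ℕ => (n * Real.log n)⁻¹ *
      pairCount z (Ico ⌊n * s⌋₊ ⌊n * t⌋₊) (Ico ⌊n * s'⌋₊ ⌊n * t'⌋₊) l) atTop (𝓝 0) := by
  refine squeeze_zero (fun n => ?_) (fun n => ?_)
    (hz.tendsto_pairCount_consecutive l hs hst (hts'.trans hst'))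
  · have := pairCount_nonneg z (Ico ⌊n * s⌋₊ ⌊n * t⌋₊) (Ico ⌊n * s'⌋₊ ⌊n * t'⌋₊) l
    positivity
  · gcongr
    exact pairCount_mono z subset_rfl
      (Ico_subset_Ico_left (Nat.floor_mono (by gcongr))) l

theorem tendsto_pairCount_Ico (hz : HasBlockAsymptotics z C) (l : G) {s : ℕ}
    {t : Fin (s + 1) → ℝ} (h0 : 0 ≤ t 0) (ht : Monotone t) (j j' : Fin s) :
    Tendsto (fun n : ℕ => (n * Real.log n)⁻¹ *
        pairCount z (Ico ⌊n * t j.castSucc⌋₊ ⌊n * t j.succ⌋₊)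
          (Ico ⌊n * t j'.castSucc⌋₊ ⌊n * t j'.succ⌋₊) l)
      atTop (𝓝 (if j = j' then C * (t j.succ - t j.castSucc) else 0)) := by
  have ht0 : ∀ i, 0 ≤ t i := fun i => h0.trans (ht (Fin.zero_le i))
  have hstep : ∀ i : Fin s, t i.castSucc ≤ t i.succ := fun i => ht i.castSucc_lt_succ.le
  have hlt : ∀ {i i' : Fin s}, i < i' → t i.succ ≤ t i'.castSucc := fun h =>
    ht (Fin.succ_le_castSucc_iff.2 h)
  rcases lt_trichotomy j j' with h | rfl | h
  · rw [if_neg h.ne]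
    exact hz.tendsto_pairCount_of_le l (ht0 _) (hstep j) (hlt h) (hstep j')
  · rw [if_pos rfl]
    exact hz l _ _ (ht0 _) (hstep j)
  · rw [if_neg h.ne']
    simp_rw [pairCount_swap z (Ico ⌊_ * t j'.castSucc⌋₊ ⌊_ * t j'.succ⌋₊)]
    exact hz.tendsto_pairCount_of_le (-l) (ht0 _) (hstep j') (hlt h) (hstep j)

theorem tendsto_pairCount_Icc (hz : HasBlockAsymptotics z C) (l : G) {s : ℕ}
    {t : Fin (s + 1) → ℝ} (h0 : 0 ≤ t 0) (ht : Monotone t) (j j' : Fin s) :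
    Tendsto (fun n : ℕ => (n * Real.log n)⁻¹ *
        pairCount z (Icc ⌊n * t j.castSucc⌋₊ ⌊n * t j.succ⌋₊)
          (Icc ⌊n * t j'.castSucc⌋₊ ⌊n * t j'.succ⌋₊) l)
      atTop (𝓝 (if j = j' then C * (t j.succ - t j.castSucc) else 0)) := by
  have ht0 : ∀ i, 0 ≤ t i := fun i => h0.trans (ht (Fin.zero_le i))
  have hlower := hz.tendsto_pairCount_Ico l h0 ht j j'
  have hupper := hlower.add
    (tendsto_floor_add_floor_add_one_div_mul_log (ht0 j.succ) (ht0 j'.succ))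
  rw [add_zero] at hupper
  refine tendsto_of_tendsto_of_tendsto_of_le_of_le hlower hupper (fun n => ?_) (fun n => ?_)
  · dsimp only
    gcongr
    exact pairCount_mono z Ico_subset_Icc_self Ico_subset_Icc_self l
  · rw [← mul_add]
    gcongr
    exact pairCount_Icc_le z _ _ _ _ l

end HasBlockAsymptotics

end Blocks

section Weyl

theorem tendsto_apply_of_tendsto_on_dense_span {𝕜 V W ι : Type*} [NontriviallyNormedField 𝕜]
    [SeminormedAddCommGroup V] [NormedSpace 𝕜 V] [SeminormedAddCommGroup W] [NormedSpace 𝕜 W]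
    {F : Filter ι} {L : ι → V →L[𝕜] W} {Λ : V →L[𝕜] W} {B : ℝ≥0} (hB : ∀ i, ‖L i‖₊ ≤ B)
    {S : Set V} (hS : (Submodule.span 𝕜 S).topologicalClosure = ⊤)
    (h : ∀ x ∈ S, Tendsto (fun i => L i x) F (𝓝 (Λ x))) (x : V) :
    Tendsto (fun i => L i x) F (𝓝 (Λ x)) := by
  have hequi : Equicontinuous fun i => ⇑(L i) :=
    (LipschitzWith.uniformEquicontinuous _ B fun i =>
      (L i).lipschitz.weaken (hB i)).equicontinuous
  have hspan : (Submodule.span 𝕜 S : Set V) ⊆ {x | Tendsto (fun i => L i x) F (𝓝 (Λ x))} := by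
    intro x hx
    rw [Set.mem_ofPred_eq]
    induction hx using Submodule.span_induction with
    | mem x hx => exact h x hx
    | zero => simpa only [map_zero] using tendsto_const_nhds
    | add x y _ _ hx hy => simpa only [map_add] using hx.add hy
    | smul c x _ hx => simpa only [map_smul] using hx.const_smul c
  refine closure_minimal hspan (hequi.isClosed_setOfPred_tendsto Λ.continuous) ?_
  rw [← Submodule.topologicalClosure_coe, hS]
  exact Submodule.mem_top

variable {d : Type*} {ν : Measure (UnitAddTorus d)} [IsFiniteMeasure ν]

theorem norm_integral_ofReal_mul_le [Finite d] {F : UnitAddTorus d → ℝ} (hF : Continuous F)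
    (h0 : ∀ t, 0 ≤ F t) (ψ : C(UnitAddTorus d, ℂ)) :
    ‖∫ t, (F t : ℂ) * ψ t ∂ν‖ ≤ (∫ t, F t ∂ν) * ‖ψ‖ := by
  rw [← integral_mul_const]
  refine norm_integral_le_of_norm_le (integrable_of_continuous (hF.mul continuous_const))
    (ae_of_all _ fun t => ?_)
  rw [norm_mul, Complex.norm_of_nonneg (h0 t)]
  gcongr
  exacts [h0 t, ψ.norm_coe_le_norm t]

/-- Weyl's criterion for convergence to a multiple of the point mass at the origin. -/
theorem tendsto_integral_of_tendsto_integral_mFourier [Fintype d] {F : ℕ → UnitAddTorus d → ℝ}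
    {S : ℂ} (hF : ∀ n, Continuous (F n)) (h0 : ∀ n t, 0 ≤ F n t)
    (hm : ∀ m : d → ℤ, Tendsto (fun n => ∫ t, (F n t : ℂ) * mFourier m t ∂ν) atTop (𝓝 S))
    (ψ : C(UnitAddTorus d, ℂ)) :
    Tendsto (fun n => ∫ t, (F n t : ℂ) * ψ t ∂ν) atTop (𝓝 (S * ψ 0)) := by
  have hint : ∀ n (ψ : C(UnitAddTorus d, ℂ)), Integrable (fun t => (F n t : ℂ) * ψ t) ν :=
    fun n ψ => integrable_of_continuous ((Complex.continuous_ofReal.comp (hF n)).mul ψ.continuous)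
  let L : ℕ → C(UnitAddTorus d, ℂ) →L[ℂ] ℂ := fun n =>
    LinearMap.mkContinuous
      { toFun := fun ψ => ∫ t, (F n t : ℂ) * ψ t ∂ν
        map_add' := fun ψ χ => by
          simp_rw [ContinuousMap.add_apply, mul_add, integral_add (hint n ψ) (hint n χ)]
        map_smul' := fun c ψ => by
          simp_rw [ContinuousMap.smul_apply, smul_eq_mul, mul_left_comm _ c, integral_const_mul,
            RingHom.id_apply] }
      (∫ t, F n t ∂ν) (norm_integral_ofReal_mul_le (hF n) (h0 n))
  have hmass : Tendsto (fun n => ∫ t, F n t ∂ν) atTop (𝓝 S.re) := by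
    have := (Complex.continuous_re.tendsto S).comp (hm 0)
    simpa only [Function.comp_def, mFourier_zero, ContinuousMap.one_apply, mul_one,
      integral_complex_ofReal, Complex.ofReal_re] using this
  obtain ⟨B, hB⟩ := hmass.bddAbove_range
  have hmass_le : ∀ n, ∫ t, F n t ∂ν ≤ B := fun n => hB ⟨n, rfl⟩
  refine tendsto_apply_of_tendsto_on_dense_span (L := L) (B := B.toNNReal)
    (Λ := S • ContinuousMap.evalCLM ℂ 0) (fun n => ?_) span_mFourier_closure_eq_top ?_ ψ
  · rw [← NNReal.coe_le_coe, coe_nnnorm]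
    exact (LinearMap.mkContinuous_norm_le _ (integral_nonneg (h0 n)) _).trans
      ((hmass_le n).trans (Real.le_coe_toNNReal B))
  · rintro _ ⟨m, rfl⟩
    simpa [L, mFourier_apply_zero] using hm m

end Weyl

section TrigPoly

variable {d ι : Type*} [Fintype d]

/-- The trigonometric polynomial `∑ i ∈ A, c i * e^{2π i ⟨v i, t⟩}`, with real coefficients. The
frequencies `v i` may repeat: they are the positions of the walk. -/
noncomputable def trigPoly (A : Finset ι) (c : ι → ℝ) (v : ι → d → ℤ) (t : UnitAddTorus d) : ℂ :=
  ∑ i ∈ A, (c i : ℂ) * mFourier (v i) t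

theorem continuous_trigPoly (A : Finset ι) (c : ι → ℝ) (v : ι → d → ℤ) :
    Continuous (trigPoly A c v) :=
  continuous_finsetSum _ fun i _ => continuous_const.mul (mFourier (v i)).continuous

theorem norm_sq_trigPoly (A : Finset ι) (c : ι → ℝ) (v : ι → d → ℤ) (t : UnitAddTorus d) :
    ((‖trigPoly A c v t‖ ^ 2 : ℝ) : ℂ) =
      ∑ i ∈ A, ∑ j ∈ A, ((c i * c j : ℝ) : ℂ) * mFourier (v i - v j) t := by
  rw [Complex.ofReal_pow, ← Complex.mul_conj', trigPoly, map_sum, sum_mul_sum]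
  refine sum_congr rfl fun i _ => sum_congr rfl fun j _ => ?_
  rw [sub_eq_add_neg, mFourier_add, mFourier_neg, map_mul, Complex.conj_ofReal]
  push_cast
  ring

theorem integral_norm_sq_trigPoly_mul {ν : Measure (UnitAddTorus d)} [IsFiniteMeasure ν]
    (A : Finset ι) (c : ι → ℝ) (v : ι → d → ℤ) {ψ : UnitAddTorus d → ℂ} (hψ : Continuous ψ) :
    ∫ t, ((‖trigPoly A c v t‖ ^ 2 : ℝ) : ℂ) * ψ t ∂ν =
      ∑ i ∈ A, ∑ j ∈ A, ((c i * c j : ℝ) : ℂ) * ∫ t, mFourier (v i - v j) t * ψ t ∂ν := by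
  have hint : ∀ i j,
      Integrable (fun t => ((c i * c j : ℝ) : ℂ) * (mFourier (v i - v j) t * ψ t)) ν :=
    fun i j => (integrable_of_continuous ((ContinuousMap.continuous _).mul hψ)).const_mul _
  simp_rw [norm_sq_trigPoly, sum_mul, mul_assoc, ← integral_const_mul]
  rw [integral_finsetSum _ fun i _ => integrable_finsetSum _ fun j _ => hint i j]
  exact sum_congr rfl fun i _ => integral_finsetSum _ fun j _ => hint i j

theorem integral_norm_sq_trigPoly_mul_mFourier (A : Finset ι) (c : ι → ℝ)
    (v : ι → Fin 2 → ℤ) (m : Fin 2 → ℤ) :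
    ∫ t, ((‖trigPoly A c v t‖ ^ 2 : ℝ) : ℂ) * mFourier m t ∂torusHaar =
      ((∑ i ∈ A, ∑ j ∈ A, c i * c j * (if v i - v j = -m then 1 else 0) : ℝ) : ℂ) := by
  rw [integral_norm_sq_trigPoly_mul A c v (mFourier m).continuous]
  simp_rw [← mFourier_add, integral_mFourier, ← eq_neg_iff_add_eq_zero]
  simp only [Complex.ofReal_sum, Complex.ofReal_mul, apply_ite Complex.ofReal, Complex.ofReal_one,
    Complex.ofReal_zero]

end TrigPoly

section Action

variable {E : Type*} [MeasurableSpace E] {μ : Measure E} {T₁ T₂ : E ≃ᵐ E}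

theorem zAction_add (hcomm : ∀ x, T₁ (T₂ x) = T₂ (T₁ x)) (k m : Fin 2 → ℤ) (x : E) :
    zAction T₁ T₂ (k + m) x = zAction T₁ T₂ k (zAction T₁ T₂ m x) := by
  have hT : Commute (T₁.toEquiv : Equiv.Perm E) T₂.toEquiv := Equiv.ext hcomm
  have hpow := (hT.zpow_zpow (m 0) (k 1)).mul_mul_mul_comm
    ((T₁.toEquiv : Equiv.Perm E) ^ k 0) ((T₂.toEquiv : Equiv.Perm E) ^ m 1)
  rw [← zpow_add, ← zpow_add] at hpow
  exact DFunLike.congr_fun hpow x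

theorem measurePreserving_zpow {T : E ≃ᵐ E} (hT : MeasurePreserving T μ μ) (k : ℤ) :
    MeasurePreserving ((T.toEquiv : Equiv.Perm E) ^ k : Equiv.Perm E) μ μ := by
  induction k with
  | zero => exact .id μ
  | succ k ih =>
    rw [zpow_add_one]
    exact ih.comp hT
  | pred k ih =>
    rw [zpow_sub_one]
    exact ih.comp hT.symm

theorem measurePreserving_zAction (hT₁ : MeasurePreserving T₁ μ μ)
    (hT₂ : MeasurePreserving T₂ μ μ) (l : Fin 2 → ℤ) :
    MeasurePreserving (zAction T₁ T₂ l) μ μ :=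
  (measurePreserving_zpow hT₁ (l 0)).comp (measurePreserving_zpow hT₂ (l 1))

theorem integral_zAction_mul_zAction (hT₁ : MeasurePreserving T₁ μ μ)
    (hT₂ : MeasurePreserving T₂ μ μ) (hcomm : ∀ x, T₁ (T₂ x) = T₂ (T₁ x)) {f : E → ℝ}
    (hf : AEStronglyMeasurable f μ) (k m : Fin 2 → ℤ) :
    ∫ x, f (zAction T₁ T₂ k x) * f (zAction T₁ T₂ m x) ∂μ =
      ∫ x, f (zAction T₁ T₂ (k - m) x) * f x ∂μ := by
  have hm := measurePreserving_zAction hT₁ hT₂ m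
  have hkm := measurePreserving_zAction hT₁ hT₂ (k - m)
  have hae : AEStronglyMeasurable (fun x => f (zAction T₁ T₂ (k - m) x) * f x)
      (μ.map (zAction T₁ T₂ m)) := by
    rw [hm.map_eq]
    exact (hf.comp_measurePreserving hkm).mul hf
  conv_rhs => rw [← hm.map_eq]
  rw [integral_map hm.measurable.aemeasurable hae]
  simp_rw [← zAction_add hcomm, sub_add_cancel]

/-- The spectral isometry: `T^l f` corresponds to the character of frequency `l` in `L²(φ dt)`. -/
theorem integral_sq_sum_zAction (hT₁ : MeasurePreserving T₁ μ μ)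
    (hT₂ : MeasurePreserving T₂ μ μ) (hcomm : ∀ x, T₁ (T₂ x) = T₂ (T₁ x)) {f : E → ℝ}
    (hf : MemLp f 2 μ) {φ : UnitAddTorus (Fin 2) → ℝ}
    (hφ : IsContinuousSpectralDensity μ T₁ T₂ f φ)
    {ι : Type*} (A : Finset ι) (c : ι → ℝ) (v : ι → Fin 2 → ℤ) :
    ((∫ x, (∑ i ∈ A, c i * f (zAction T₁ T₂ (v i) x)) ^ 2 ∂μ : ℝ) : ℂ) =
      ∫ t, ((‖trigPoly A c v t‖ ^ 2 : ℝ) : ℂ) * (φ t : ℂ) ∂torusHaar := by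
  have hL2 : ∀ k, MemLp (fun x => f (zAction T₁ T₂ k x)) 2 μ := fun k =>
    hf.comp_measurePreserving (measurePreserving_zAction hT₁ hT₂ k)
  have hint : ∀ i j, Integrable
      (fun x => c i * c j * (f (zAction T₁ T₂ (v i) x) * f (zAction T₁ T₂ (v j) x))) μ :=
    fun i j => ((hL2 (v i)).integrable_mul (hL2 (v j))).const_mul _
  have hexpand : ∫ x, (∑ i ∈ A, c i * f (zAction T₁ T₂ (v i) x)) ^ 2 ∂μ =
      ∑ i ∈ A, ∑ j ∈ A, c i * c j * ∫ x, f (zAction T₁ T₂ (v i - v j) x) * f x ∂μ := by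
    simp_rw [← integral_zAction_mul_zAction hT₁ hT₂ hcomm hf.1, ← integral_const_mul, sq,
      sum_mul_sum, mul_mul_mul_comm]
    rw [integral_finsetSum _ fun i _ => integrable_finsetSum _ fun j _ => hint i j]
    exact sum_congr rfl fun i _ => integral_finsetSum _ fun j _ => hint i j
  rw [hexpand, integral_norm_sq_trigPoly_mul A c v (ψ := fun t => (φ t : ℂ))
    (Complex.continuous_ofReal.comp hφ.1)]
  simp_rw [Complex.ofReal_sum, Complex.ofReal_mul, hφ.2]

end Action

section Energy

/-- The trigonometric polynomial corresponding to `blockSum` under the spectral isometry, along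
the path `z`. -/
noncomputable def blockTrigPoly (z : ℕ → Fin 2 → ℤ) {s : ℕ} (a : Fin s → ℝ)
    (t : Fin (s + 1) → ℝ) (n : ℕ) : UnitAddTorus (Fin 2) → ℂ :=
  trigPoly (univ.sigma fun j => Icc ⌊n * t j.castSucc⌋₊ ⌊n * t j.succ⌋₊) (fun p => a p.1)
    (fun p => z p.2)

theorem integral_norm_sq_blockTrigPoly_mul_mFourier (z : ℕ → Fin 2 → ℤ) {s : ℕ} (a : Fin s → ℝ)
    (t : Fin (s + 1) → ℝ) (n : ℕ) (m : Fin 2 → ℤ) :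
    ∫ τ, ((‖blockTrigPoly z a t n τ‖ ^ 2 : ℝ) : ℂ) * mFourier m τ ∂torusHaar =
      ((∑ j, ∑ j', a j * a j' * pairCount z (Icc ⌊n * t j.castSucc⌋₊ ⌊n * t j.succ⌋₊)
        (Icc ⌊n * t j'.castSucc⌋₊ ⌊n * t j'.succ⌋₊) (-m) : ℝ) : ℂ) := by
  simp_rw [blockTrigPoly, integral_norm_sq_trigPoly_mul_mFourier, sum_sigma, pairCount, mul_sum]
  exact congrArg _ (sum_congr rfl fun j _ => sum_comm)

namespace HasBlockAsymptotics

variable {z : ℕ → Fin 2 → ℤ} {C : ℝ} {s : ℕ} {t : Fin (s + 1) → ℝ}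

theorem tendsto_integral_norm_sq_blockTrigPoly_mul_mFourier (hz : HasBlockAsymptotics z C)
    (a : Fin s → ℝ) (h0 : 0 ≤ t 0) (ht : Monotone t) (m : Fin 2 → ℤ) :
    Tendsto (fun n : ℕ => ∫ τ, (((n * Real.log n)⁻¹ * ‖blockTrigPoly z a t n τ‖ ^ 2 : ℝ) : ℂ) *
        mFourier m τ ∂torusHaar) atTop
      (𝓝 ((C * ∑ j, a j ^ 2 * (t j.succ - t j.castSucc) : ℝ) : ℂ)) := by
  have hlim : ∑ j, ∑ j', a j * a j' * (if j = j' then C * (t j.succ - t j.castSucc) else 0) =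
      C * ∑ j, a j ^ 2 * (t j.succ - t j.castSucc) := by
    simp only [mul_ite, mul_zero, sum_ite_eq, mem_univ, if_true, mul_sum]
    exact sum_congr rfl fun j _ => by ring
  rw [← hlim]
  refine ((Complex.continuous_ofReal.tendsto _).comp (tendsto_finsetSum _ fun j _ =>
    tendsto_finsetSum _ fun j' _ => (hz.tendsto_pairCount_Icc (-m) h0 ht j j').const_mul
      (a j * a j'))).congr fun n => ?_
  simp_rw [Complex.ofReal_mul (_⁻¹), mul_assoc, integral_const_mul,
    integral_norm_sq_blockTrigPoly_mul_mFourier, ← Complex.ofReal_mul, mul_sum, Function.comp_apply]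
  exact congrArg _ (sum_congr rfl fun j _ => sum_congr rfl fun j' _ => by ring)

theorem tendsto_integral_sq_sum_zAction (hz : HasBlockAsymptotics z C)
    {E : Type*} [MeasurableSpace E] {μ : Measure E} {T₁ T₂ : E ≃ᵐ E}
    (hT₁ : MeasurePreserving T₁ μ μ) (hT₂ : MeasurePreserving T₂ μ μ)
    (hcomm : ∀ x, T₁ (T₂ x) = T₂ (T₁ x)) {f : E → ℝ} (hf : MemLp f 2 μ)
    {φ : UnitAddTorus (Fin 2) → ℝ} (hφ : IsContinuousSpectralDensity μ T₁ T₂ f φ)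
    (a : Fin s → ℝ) (h0 : 0 ≤ t 0) (ht : Monotone t) :
    Tendsto (fun n : ℕ => (n * Real.log n)⁻¹ * ∫ x, (∑ j : Fin s, a j *
        ∑ k ∈ Icc ⌊n * t j.castSucc⌋₊ ⌊n * t j.succ⌋₊, f (zAction T₁ T₂ (z k) x)) ^ 2 ∂μ) atTop
      (𝓝 (C * (∑ j, a j ^ 2 * (t j.succ - t j.castSucc)) * φ 0)) := by
  have hweyl := tendsto_integral_of_tendsto_integral_mFourier
    (F := fun n τ => (n * Real.log n)⁻¹ * ‖blockTrigPoly z a t n τ‖ ^ 2)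
    (fun n => continuous_const.mul ((continuous_trigPoly _ _ _).norm.pow 2))
    (fun n τ => by positivity)
    (hz.tendsto_integral_norm_sq_blockTrigPoly_mul_mFourier a h0 ht)
    ⟨fun τ => (φ τ : ℂ), Complex.continuous_ofReal.comp hφ.1⟩
  rw [ContinuousMap.coe_mk, ← Complex.ofReal_mul] at hweyl
  refine tendsto_ofReal_iff.1 (hweyl.congr fun n => ?_)
  simp_rw [Complex.ofReal_mul (_⁻¹), mul_assoc, integral_const_mul, blockTrigPoly,
    ← integral_sq_sum_zAction hT₁ hT₂ hcomm hf hφ, sum_sigma, mul_sum]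

end HasBlockAsymptotics

theorem IsPlanarWalk.selfIntersectionConst_pos {Ω : Type*} [MeasurableSpace Ω] {P : Measure Ω}
    {ζ : ℕ → Ω → (Fin 2 → ℤ)} (h : IsPlanarWalk P ζ) :
    0 < selfIntersectionConst (covMatrix P (ζ 0)) :=
  have := h.isProbabilityMeasure
  inv_pos.2 (mul_pos Real.pi_pos (Real.sqrt_pos.2 (posDef_covMatrix h.memLp h.det_ne_zero).det_pos))

end Energy

end QuenchedRW

theorem lemma1p5_general
    {Ω : Type*} [MeasurableSpace Ω] (P : Measure Ω)
    (ζ : ℕ → Ω → (Fin 2 → ℤ))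
    (hmeas : ∀ i, Measurable (ζ i))
    (hindep : iIndepFun ζ P)
    (hident : ∀ i, IdentDistrib (ζ i) (ζ 0) P P)
    (haper : QuenchedRW.IsAperiodic P (ζ 0))
    (hL2 : ∀ c : Fin 2, MemLp (fun ω => (ζ 0 ω c : ℝ)) 2 P)
    (hmean : ∀ c : Fin 2, ∫ ω, (ζ 0 ω c : ℝ) ∂P = 0)
    (hcov : (QuenchedRW.covMatrix P (ζ 0)).det ≠ 0)
    {E : Type*} [MeasurableSpace E] (μ : Measure E)
    (T₁ T₂ : E ≃ᵐ E)
    (hT₁ : MeasurePreserving T₁ μ μ) (hT₂ : MeasurePreserving T₂ μ μ)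
    (hcomm : ∀ x, T₁ (T₂ x) = T₂ (T₁ x))
    (f : E → ℝ) (hf : MemLp f 2 μ)
    (φ : UnitAddTorus (Fin 2) → ℝ)
    (hφ : QuenchedRW.IsContinuousSpectralDensity μ T₁ T₂ f φ) :
    ∀ᵐ ω ∂P, ∀ (s : ℕ) (a : Fin s → ℝ) (t : Fin (s + 1) → ℝ),
      0 ≤ t 0 → Monotone t →
      Tendsto
        (fun n : ℕ =>
          (QuenchedRW.selfIntersectionConst (QuenchedRW.covMatrix P (ζ 0)) *
              (n : ℝ) * Real.log n)⁻¹ *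
            ∫ x, (QuenchedRW.blockSum ζ T₁ T₂ f a t n ω x) ^ 2 ∂μ)
        atTop
        (𝓝 (φ 0 * ∑ j : Fin s, a j ^ 2 * (t j.succ - t j.castSucc))) := by
  have h : QuenchedRW.IsPlanarWalk P ζ := ⟨⟨hmeas, hindep, hident⟩, haper, hL2, hmean, hcov⟩
  have hC := h.selfIntersectionConst_pos.ne'
  filter_upwards [h.ae_hasBlockAsymptotics] with ω hω s a t h0 ht
  have henergy := (hω.tendsto_integral_sq_sum_zAction hT₁ hT₂ hcomm hf hφ a h0 ht).const_mul
    (QuenchedRW.selfIntersectionConst (QuenchedRW.covMatrix P (ζ 0)))⁻¹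
  rw [← mul_assoc, inv_mul_cancel_left₀ hC, mul_comm] at henergy
  exact henergy.congr fun n => by rw [← mul_assoc, ← mul_inv, ← mul_assoc]; rfl

theorem lemma1p5
    {Ω : Type*} [MeasurableSpace Ω] (P : Measure Ω) [IsProbabilityMeasure P]
    (ζ : ℕ → Ω → (Fin 2 → ℤ))
    (hmeas : ∀ i, Measurable (ζ i))
    (hindep : iIndepFun ζ P)
    (hident : ∀ i, IdentDistrib (ζ i) (ζ 0) P P)
    (haper : QuenchedRW.IsAperiodic P (ζ 0))
    (hL2 : ∀ c : Fin 2, MemLp (fun ω => (ζ 0 ω c : ℝ)) 2 P)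
    (hmean : ∀ c : Fin 2, ∫ ω, (ζ 0 ω c : ℝ) ∂P = 0)
    (hcov : (QuenchedRW.covMatrix P (ζ 0)).det ≠ 0)
    {E : Type*} [MeasurableSpace E] (μ : Measure E) [IsProbabilityMeasure μ]
    (T₁ T₂ : E ≃ᵐ E)
    (hT₁ : MeasurePreserving T₁ μ μ) (hT₂ : MeasurePreserving T₂ μ μ)
    (hcomm : ∀ x, T₁ (T₂ x) = T₂ (T₁ x))
    (f : E → ℝ) (hf : MemLp f 2 μ)
    (φ : UnitAddTorus (Fin 2) → ℝ)
    (hφ : QuenchedRW.IsContinuousSpectralDensity μ T₁ T₂ f φ) :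
    ∀ᵐ ω ∂P, ∀ (s : ℕ) (a : Fin s → ℝ) (t : Fin (s + 1) → ℝ),
      t 0 = 0 → t (Fin.last s) = 1 → StrictMono t →
      Tendsto
        (fun n : ℕ =>
          (QuenchedRW.selfIntersectionConst (QuenchedRW.covMatrix P (ζ 0)) *
              (n : ℝ) * Real.log n)⁻¹ *
            ∫ x, (QuenchedRW.blockSum ζ T₁ T₂ f a t n ω x) ^ 2 ∂μ)
        atTop
        (𝓝 (φ 0 * ∑ j : Fin s, a j ^ 2 * (t j.succ - t j.castSucc))) := by
  filter_upwards [lemma1p5_general P ζ hmeas hindep hident haper hL2 hmean hcov μ T₁ T₂ hT₁ hT₂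
    hcomm f hf φ hφ] with ω hω s a t h0 _ ht using hω s a t h0.ge ht.monotone
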